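/- Let $\mathbb{H}=\{(z_1,z_2)\in\mathbb{C}^2 : |z_1|<|z_2|<1\}$ be the Hartogs triangle and $dV$ Lebesgue measure. For a positive continuous function $\mu$ on $\mathbb{H}$ and $1\le p<\infty$ let $L^p(\mathbb{H},\mu)$ be the $L^p$ space of the measure $\mu\,dV$ on $\mathbb{H}$, let $A^2(\mathbb{H},\mu)$ be the closed subspace of $L^2(\mathbb{H},\mu)$ consisting of holomorphic functions, and let the weighted Bergman projection $\mathcal{B}_{\mathbb{H},\mu}$ be the orthogonal projection from $L^2(\mathbb{H},\mu)$ to $A^2(\mathbb{H},\mu)$. It is called $L^p(\mathbb{H},\mu)$ bounded if there is a constant $C<\infty$ with $\|\mathcal{B}_{\mathbb{H},\mu}f\|_{L^p(\mathbb{H},\mu)}\le C\|f\|_{L^p(\mathbb{H},\mu)}$ for all $f\in L^2(\mathbb{H},\mu)\cap L^p(\mathbb{H},\mu)$. Let $p_0\in[1,2)$, let $p_0'\in(2,\infty]$ be its conjugate exponent, $\frac1{p_0}+\frac1{p_0'}=1$ (so $p_0'=\infty$ if $p_0=1$), and let $\mu(z)=|z_2|^{-(p_0+4)}$ for $z\in\mathbb{H}$.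 Then, for $1\le p<\infty$, $\mathcal{B}_{\mathbb{H},\mu}$ is $L^p(\mathbb{H},\mu)$ bounded if and only if $p\in(p_0,p_0')$. In particular, unbounded weights can shrink the range of $p$ arbitrarily: for every $\varepsilon>0$ there is $s\in\mathbb{R}$ such that the weight $\mu(z)=|z_2|^{s}$ is unbounded on $\mathbb{H}$ and every $p\in[1,\infty)$ for which $\mathcal{B}_{\mathbb{H},\mu}$ is $L^p(\mathbb{H},\mu)$ bounded lies in $(2-\varepsilon,2+\varepsilon)$. -/

import Mathlib

open MeasureTheory Set Filter Topology Metric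
open scoped ENNReal NNReal

section General

/-- A locally uniform limit of holomorphic functions is holomorphic. -/
theorem differentiableAt_of_uniformCauchySeqOn {E : Type*} [NormedAddCommGroup E]
    [NormedSpace ℂ E] {F : ℕ → E → ℂ} {f : E → ℂ} {a : E} {r : ℝ}
    (hr : 0 < r) (hF : ∀ n, DifferentiableOn ℂ (F n) (ball a r))
    (hC : UniformCauchySeqOn F atTop (ball a r))
    (hf : ∀ z ∈ ball a r, Tendsto (fun n => F n z) atTop (𝓝 (f z))) :
    DifferentiableAt ℂ f a := by
  have hsub : ball a (r / 2) ⊆ ball a r := ball_subset_ball (by linarith)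
  have hdiff : ∀ n, ∀ z ∈ ball a r, DifferentiableAt ℂ (F n) z := fun n z hz =>
    (hF n).differentiableAt (isOpen_ball.mem_nhds hz)
  have hC' : UniformCauchySeqOn (fun n => fderiv ℂ (F n)) atTop (ball a (r / 2)) := by
    rw [Metric.uniformCauchySeqOn_iff] at hC ⊢
    intro ε hε
    obtain ⟨N, hN⟩ := hC (ε * r / 8) (by positivity)
    refine ⟨N, fun m hm n hn z hz => ?_⟩
    have hzr : ball z (r / 2) ⊆ ball a r := by
      refine ball_subset_ball' ?_
      have := mem_ball.1 hz
      linarith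
    have hb : ∀ w ∈ ball a r, ‖(F m - F n) w‖ ≤ ε * r / 8 := fun w hw => by
      have := (hN m hm n hn w hw).le
      rwa [dist_eq_norm] at this
    have h1 : ‖fderiv ℂ (F m - F n) z‖ ≤ (ε * r / 4) / (r / 2) := by
      refine Complex.norm_fderiv_le_div_of_mapsTo_ball
        (((hF m).sub (hF n)).mono hzr) (fun w hw => ?_) (by positivity)
      rw [mem_closedBall, dist_eq_norm]
      have h3 := norm_sub_le ((F m - F n) w) ((F m - F n) z)
      have h4 := hb w (hzr hw)
      have h5 := hb z (hsub hz)
      linarith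
    rw [fderiv_sub (hdiff m z (hsub hz)) (hdiff n z (hsub hz))] at h1
    rw [dist_eq_norm]
    refine h1.trans_lt ?_
    rw [div_lt_iff₀ (by positivity)]
    nlinarith [mul_pos hε hr]
  have hlim : ∀ z ∈ ball a (r / 2),
      ∃ L, Tendsto (fun n => fderiv ℂ (F n) z) atTop (𝓝 L) := fun z hz =>
    cauchySeq_tendsto_of_complete (hC'.cauchySeq hz)
  choose! g' hg' using hlim
  exact (hasFDerivAt_of_tendstoUniformlyOn isOpen_ball
    (hC'.tendstoUniformlyOn_of_tendsto hg')
    (fun n z hz => (hdiff n z (hsub hz)).hasFDerivAt) (fun z hz => hf z (hsub hz))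
    (mem_ball_self (by positivity))).differentiableAt

variable {E : Type*} [NormedAddCommGroup E] [NormedSpace ℂ E] [MeasureSpace E]

/-- The measure `μ dV` on a domain `Ω`, where `μ` is a nonnegative weight and `dV` is volume. -/
noncomputable def weightedMeasure (Ω : Set E) (μ : E → ℝ) : Measure E :=
  (volume.restrict Ω).withDensity fun z => ENNReal.ofReal (μ z)

/-- The weighted Bergman space `A²(Ω, μ) = L²(Ω, μ) ∩ 𝒪(Ω)`: the classes in `L²(Ω, μ)` that have a
representative which is holomorphic on `Ω`. -/
noncomputable def bergmanSpace (Ω : Set E) (μ : E → ℝ) :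
    Submodule ℂ (Lp ℂ 2 (weightedMeasure Ω μ)) where
  carrier := {F | ∃ f : E → ℂ, DifferentiableOn ℂ f Ω ∧ F =ᵐ[weightedMeasure Ω μ] f}
  zero_mem' := ⟨fun _ => 0, differentiableOn_const _, Lp.coeFn_zero _ _ _⟩
  add_mem' := by
    rintro F G ⟨f, hf, hF⟩ ⟨g, hg, hG⟩
    exact ⟨f + g, hf.add hg, (Lp.coeFn_add F G).trans (hF.add hG)⟩
  smul_mem' := by
    rintro c F ⟨f, hf, hF⟩
    exact ⟨c • f, hf.const_smul c, (Lp.coeFn_smul c F).trans (hF.const_smul c)⟩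

/-- The weighted Bergman projection: the orthogonal projection from `L²(Ω, μ)` to `A²(Ω, μ)`. -/
noncomputable def bergmanProjection (Ω : Set E) (μ : E → ℝ)
    [(bergmanSpace Ω μ).HasOrthogonalProjection] :
    Lp ℂ 2 (weightedMeasure Ω μ) →L[ℂ] Lp ℂ 2 (weightedMeasure Ω μ) :=
  (bergmanSpace Ω μ).starProjection

/-- The weighted Bergman projection is `Lᵖ(Ω, μ)` bounded: on the subspace `L²(Ω, μ) ∩ Lᵖ(Ω, μ)`,
which is dense in `Lᵖ(Ω, μ)` for finite `p`, it is bounded in the `Lᵖ(Ω, μ)` norm. -/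
def BergmanProjectionLpBounded (Ω : Set E) (μ : E → ℝ)
    [(bergmanSpace Ω μ).HasOrthogonalProjection] (p : ℝ) : Prop :=
  ∃ C : ℝ≥0, ∀ f : Lp ℂ 2 (weightedMeasure Ω μ),
    MemLp f (ENNReal.ofReal p) (weightedMeasure Ω μ) →
      eLpNorm (bergmanProjection Ω μ f) (ENNReal.ofReal p) (weightedMeasure Ω μ) ≤
        C * eLpNorm f (ENNReal.ofReal p) (weightedMeasure Ω μ)

theorem ae_mem_of_weightedMeasure {X : Type*} [MeasureSpace X] {Ω : Set X} (hΩ : MeasurableSet Ω) (μ : X → ℝ) :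
    ∀ᵐ z ∂(weightedMeasure Ω μ), z ∈ Ω :=
  (withDensity_absolutelyContinuous _ _).ae_le (ae_restrict_mem hΩ)

variable [BorelSpace E] [FiniteDimensional ℂ E] [(volume : Measure E).IsAddHaarMeasure]

/-- Rotations of a complex vector space preserve volume. -/
theorem lintegral_rotate (a : E) (u : Circle) (h : E → ℝ≥0∞) :
    ∫⁻ v, h (a + (u : ℂ) • v) = ∫⁻ z, h z := by
  have : ProperSpace E := FiniteDimensional.proper ℂ E
  let L : E ≃L[ℂ] E := (LinearEquiv.smulOfNeZero ℂ E (u : ℂ) (Circle.coe_ne_zero u))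
    |>.toContinuousLinearEquiv
  have hL : ∀ v, L v = (u : ℂ) • v := fun v => rfl
  have hpre : L ⁻¹' (ball (0 : E) 1) = ball 0 1 := by
    ext v
    simp [hL, norm_smul, Circle.norm_coe]
  have hmap : (volume : Measure E).map L = volume := by
    have h1 := Measure.isAddLeftInvariant_eq_smul ((volume : Measure E).map L) volume
    have h2 : (volume : Measure E).map L (ball 0 1) = volume (ball (0 : E) 1) := by
      rw [Measure.map_apply L.continuous.measurable measurableSet_ball, hpre]
    rw [h1, Measure.smul_apply, ENNReal.smul_def, smul_eq_mul] at h2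
    have h3 : ((((volume : Measure E).map L).addHaarScalarFactor volume : ℝ≥0) : ℝ≥0∞) = 1 := by
      have hp : volume (ball (0 : E) 1) ≠ 0 := (measure_ball_pos _ _ one_pos).ne'
      have hf : volume (ball (0 : E) 1) ≠ ∞ := measure_ball_lt_top.ne
      exact (ENNReal.mul_left_inj hp hf).1 (by rw [h2, one_mul])
    rw [h1, show ((volume : Measure E).map L).addHaarScalarFactor volume = 1 by exact_mod_cast h3,
      one_smul]
  have hmp : MeasurePreserving L (volume : Measure E) volume := ⟨L.continuous.measurable, hmap⟩
  calc ∫⁻ v, h (a + (u : ℂ) • v) = ∫⁻ v, (fun z => h (a + z)) (L v) := rfl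
    _ = ∫⁻ z, h (a + z) :=
      hmp.lintegral_comp_emb L.toHomeomorph.measurableEmbedding (fun z => h (a + z))
    _ = ∫⁻ z, h z := lintegral_add_left_eq_self _ _

/-- The mean value inequality over balls for holomorphic functions. -/
theorem enorm_mul_volume_ball_le {f : E → ℂ} {a : E} {r : ℝ}
    (hf : DifferentiableOn ℂ f (ball a r)) :
    ‖f a‖ₑ * volume (ball a r) ≤ ∫⁻ z in ball a r, ‖f z‖ₑ := by
  have : ProperSpace E := FiniteDimensional.proper ℂ E
  let h : E → ℝ≥0∞ := (ball a r).indicator fun z => ‖f z‖ₑ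
  have hm : Measurable h := by
    classical
    have : Measurable ((ball a r).piecewise f 0) :=
      hf.continuousOn.measurable_piecewise continuousOn_const measurableSet_ball
    convert this.enorm using 1
    ext z
    by_cases hz : z ∈ ball a r <;> simp [h, hz]
  let I : Set ℝ := Ioc 0 (2 * Real.pi)
  have hI : volume I = ENNReal.ofReal (2 * Real.pi) := by simp [I]
  have hI0 : volume I ≠ 0 := by rw [hI]; simp [Real.pi_pos]
  have hIt : volume I ≠ ∞ := by rw [hI]; exact ENNReal.ofReal_ne_top
  have key : ∀ v ∈ ball (0 : E) r,
      volume I * ‖f a‖ₑ ≤ ∫⁻ θ in I, h (a + (Circle.exp θ : ℂ) • v) := by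
    intro v hv
    have hv' : ‖v‖ < r := by simpa using hv
    have hmem : ∀ t : ℂ, ‖t‖ ≤ 1 → a + t • v ∈ ball a r := by
      intro t ht
      simp only [mem_ball, dist_self_add_left, norm_smul]
      nlinarith [norm_nonneg v]
    have hd : DifferentiableOn ℂ (fun t : ℂ => f (a + t • v)) (closedBall 0 1) := by
      refine hf.comp (by fun_prop) fun t ht => hmem t (by simpa using ht)
    have hdc : DiffContOnCl ℂ (fun t : ℂ => f (a + t • v)) (ball 0 |1|) := by
      rw [abs_one]
      exact hd.diffContOnCl_ball Subset.rfl
    have h1 := hdc.circleAverage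
    rw [Real.circleAverage, intervalIntegral.integral_of_le (by positivity)] at h1
    simp only [zero_smul, add_zero] at h1
    have h2 : (2 * Real.pi) • f a = ∫ θ in I, f (a + circleMap 0 1 θ • v) := by
      rw [← h1, smul_smul, mul_inv_cancel₀ (by positivity), one_smul]
    calc volume I * ‖f a‖ₑ = ‖(2 * Real.pi) • f a‖ₑ := by
          rw [enorm_smul, hI, Real.enorm_eq_ofReal (by positivity)]
      _ ≤ ∫⁻ θ in I, ‖f (a + circleMap 0 1 θ • v)‖ₑ := by
          rw [h2]; exact enorm_integral_le_lintegral_enorm _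
      _ = ∫⁻ θ in I, h (a + (Circle.exp θ : ℂ) • v) := by
          congr 1 with θ
          have : circleMap 0 1 θ = (Circle.exp θ : ℂ) := by simp [circleMap]
          rw [this]
          exact (indicator_of_mem (hmem _ (by simp)) (fun z => ‖f z‖ₑ)).symm
  have hjm : Measurable fun q : E × ℝ => h (a + (Circle.exp q.2 : ℂ) • q.1) :=
    hm.comp (Continuous.measurable (by fun_prop))
  have hvol : volume (ball a r) = volume (ball (0 : E) r) := Measure.addHaar_ball_center _ _ _
  refine (ENNReal.mul_le_mul_iff_right hI0 hIt).1 ?_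
  calc volume I * (‖f a‖ₑ * volume (ball a r))
      = ∫⁻ _ in ball (0 : E) r, volume I * ‖f a‖ₑ := by
        rw [setLIntegral_const, hvol, mul_assoc]
    _ ≤ ∫⁻ v in ball (0 : E) r, ∫⁻ θ in I, h (a + (Circle.exp θ : ℂ) • v) :=
        setLIntegral_mono' measurableSet_ball key
    _ ≤ ∫⁻ v : E, ∫⁻ θ in I, h (a + (Circle.exp θ : ℂ) • v) := setLIntegral_le_lintegral _ _
    _ = ∫⁻ θ in I, ∫⁻ v : E, h (a + (Circle.exp θ : ℂ) • v) :=
        lintegral_lintegral_swap hjm.aemeasurable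
    _ = ∫⁻ θ in I, ∫⁻ z, h z := by simp_rw [lintegral_rotate]
    _ = volume I * ∫⁻ z in ball a r, ‖f z‖ₑ := by
        rw [setLIntegral_const, mul_comm, lintegral_indicator measurableSet_ball]

/-- On small balls a holomorphic function is bounded by its weighted `L²` norm. -/
theorem exists_ball_bound {Ω : Set E} {μ : E → ℝ} (hΩ : IsOpen Ω) (hμ : ContinuousOn μ Ω)
    (hpos : ∀ z ∈ Ω, 0 < μ z) {a : E} (ha : a ∈ Ω) :
    ∃ r > 0, ball a r ⊆ Ω ∧ ∃ C : ℝ≥0, ∀ f : E → ℂ, DifferentiableOn ℂ f Ω → ∀ z ∈ ball a r,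
      ‖f z‖ₑ ≤ C * eLpNorm f 2 (weightedMeasure Ω μ) := by
  have hc : 0 < μ a := hpos a ha
  have hnear : ∀ᶠ z in 𝓝 a, z ∈ Ω ∧ μ a / 2 < μ z :=
    (show ∀ᶠ z in 𝓝 a, z ∈ Ω from hΩ.mem_nhds ha).and ((hμ.continuousAt (hΩ.mem_nhds ha)).eventually
      (lt_mem_nhds (half_lt_self hc)))
  obtain ⟨R, hR, hball⟩ := Metric.eventually_nhds_iff_ball.1 hnear
  refine ⟨R / 2, by positivity, fun z hz => (hball z (ball_subset_ball (by linarith) hz)).1, ?_⟩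
  set c : ℝ≥0∞ := ENNReal.ofReal (μ a / 2) with hcdef
  set V : ℝ≥0∞ := volume (ball (0 : E) (R / 2)) with hV
  have hc0 : c ≠ 0 := by simp [hcdef, hc]
  have hct : c ≠ ∞ := ENNReal.ofReal_ne_top
  have hV0 : V ≠ 0 := (measure_ball_pos _ _ (by positivity)).ne'
  have : ProperSpace E := FiniteDimensional.proper ℂ E
  have hVt : V ≠ ∞ := measure_ball_lt_top.ne
  have hD : (c * V)⁻¹ ≠ ∞ := ENNReal.inv_ne_top.2 (mul_ne_zero hc0 hV0)
  refine ⟨(((c * V)⁻¹) ^ (1 / 2 : ℝ)).toNNReal, fun f hf z hz => ?_⟩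
  rw [ENNReal.coe_toNNReal (ENNReal.rpow_ne_top_of_nonneg (by norm_num) hD)]
  have hsub : ball z (R / 2) ⊆ ball a R := by
    refine ball_subset_ball' ?_
    have := mem_ball.1 hz
    linarith
  have hsubΩ : ball z (R / 2) ⊆ Ω := fun w hw => (hball w (hsub hw)).1
  have h1 := enorm_mul_volume_ball_le (f := fun w => f w ^ 2) ((hf.mono hsubΩ).pow 2)
  rw [Measure.addHaar_ball_center] at h1
  have h2 : c * ∫⁻ w in ball z (R / 2), ‖f w ^ 2‖ₑ
      ≤ ∫⁻ w, ‖f w‖ₑ ^ (2 : ℝ) ∂(weightedMeasure Ω μ) := by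
    have hwm : AEMeasurable (fun z => ENNReal.ofReal (μ z)) (volume.restrict Ω) :=
      (hμ.aemeasurable hΩ.measurableSet).ennreal_ofReal
    rw [weightedMeasure, lintegral_withDensity_eq_lintegral_mul₀ hwm
      ((hf.continuousOn.aemeasurable hΩ.measurableSet).enorm.pow_const _)]
    rw [← lintegral_const_mul' _ _ hct]
    refine le_trans ?_ (lintegral_mono_set hsubΩ)
    refine setLIntegral_mono' measurableSet_ball fun w hw => ?_
    simp only [Pi.mul_apply, enorm_pow, ENNReal.rpow_ofNat]
    gcongr
    exact ENNReal.ofReal_le_ofReal (hball w (hsub hw)).2.le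
  rw [eLpNorm_eq_lintegral_rpow_enorm_toReal (by norm_num) (by norm_num)]
  simp only [ENNReal.toReal_ofNat]
  rw [← ENNReal.mul_rpow_of_nonneg _ _ (by norm_num)]
  have h3 : ‖f z‖ₑ ^ (2 : ℝ) ≤
      (c * V)⁻¹ * ∫⁻ w, ‖f w‖ₑ ^ (2 : ℝ) ∂(weightedMeasure Ω μ) := by
    rw [mul_comm, ← div_eq_mul_inv, ENNReal.le_div_iff_mul_le
      (Or.inl (mul_ne_zero hc0 hV0)) (Or.inl (ENNReal.mul_ne_top hct hVt))]
    calc ‖f z‖ₑ ^ (2 : ℝ) * (c * V) = c * (‖f z ^ 2‖ₑ * V) := by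
          rw [enorm_pow, ENNReal.rpow_ofNat]; ring
      _ ≤ c * ∫⁻ w in ball z (R / 2), ‖f w ^ 2‖ₑ := by gcongr
      _ ≤ _ := h2
  calc ‖f z‖ₑ = (‖f z‖ₑ ^ (2 : ℝ)) ^ (1 / 2 : ℝ) := by
        rw [← ENNReal.rpow_mul]; norm_num
    _ ≤ _ := ENNReal.rpow_le_rpow h3 (by norm_num)

/-- For a continuous positive weight on an open set, `A²(Ω, μ)` is closed in `L²(Ω, μ)`. -/
theorem isClosed_bergmanSpace {Ω : Set E} {μ : E → ℝ} (hΩ : IsOpen Ω) (hμ : ContinuousOn μ Ω)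
    (hpos : ∀ z ∈ Ω, 0 < μ z) :
    IsClosed (bergmanSpace Ω μ : Set (Lp ℂ 2 (weightedMeasure Ω μ))) := by
  refine isClosed_of_closure_subset fun G hG => ?_
  obtain ⟨F, hF, hFG⟩ := mem_closure_iff_seq_limit.1 hG
  choose f hf hFf using hF
  have hcauchy : ∀ a ∈ Ω, ∃ r > 0, ball a r ⊆ Ω ∧ UniformCauchySeqOn f atTop (ball a r) := by
    intro a ha
    obtain ⟨r, hr, hsub, C, hC⟩ := exists_ball_bound hΩ hμ hpos ha
    refine ⟨r, hr, hsub, ?_⟩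
    rw [Metric.uniformCauchySeqOn_iff]
    intro ε hε
    obtain ⟨N, hN⟩ := Metric.cauchySeq_iff.1 hFG.cauchySeq (ε / (C + 1)) (by positivity)
    refine ⟨N, fun m hm n hn z hz => ?_⟩
    have h1 := hC (f m - f n) ((hf m).sub (hf n)) z hz
    have h2 : eLpNorm (f m - f n) 2 (weightedMeasure Ω μ) = ‖F m - F n‖ₑ := by
      rw [Lp.enorm_def]
      exact eLpNorm_congr_ae (((hFf m).sub (hFf n)).symm.trans (Lp.coeFn_sub _ _).symm)
    rw [h2] at h1
    have h3 : ‖f m z - f n z‖ ≤ C * ‖F m - F n‖ := by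
      have := ENNReal.toReal_mono (ENNReal.mul_ne_top ENNReal.coe_ne_top enorm_ne_top) h1
      simpa using this
    have h4 := hN m hm n hn
    rw [dist_eq_norm] at h4 ⊢
    have hC1 : (0 : ℝ) < C + 1 := by positivity
    rw [lt_div_iff₀ hC1] at h4
    nlinarith [norm_nonneg (F m - F n)]
  have hlim : ∀ z ∈ Ω, ∃ L, Tendsto (fun n => f n z) atTop (𝓝 L) := by
    intro z hz
    obtain ⟨r, hr, -, hu⟩ := hcauchy z hz
    exact cauchySeq_tendsto_of_complete (hu.cauchySeq (mem_ball_self hr))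
  choose! g hg using hlim
  refine ⟨g, fun a ha => ?_, ?_⟩
  · obtain ⟨r, hr, hsub, hu⟩ := hcauchy a ha
    exact (differentiableAt_of_uniformCauchySeqOn hr (fun n => (hf n).mono hsub) hu
      fun z hz => hg z (hsub hz)).differentiableWithinAt
  · obtain ⟨φ, hφ, hae⟩ := (tendstoInMeasure_of_tendsto_Lp hFG).exists_seq_tendsto_ae
    filter_upwards [hae, ae_mem_of_weightedMeasure hΩ.measurableSet μ, ae_all_iff.2 hFf]
      with z h1 h2 h3
    simp only [h3] at h1
    exact tendsto_nhds_unique h1 ((hg z h2).comp hφ.tendsto_atTop)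

theorem hasOrthogonalProjection_bergmanSpace {Ω : Set E} {μ : E → ℝ} (hΩ : IsOpen Ω)
    (hμ : ContinuousOn μ Ω) (hpos : ∀ z ∈ Ω, 0 < μ z) :
    (bergmanSpace Ω μ).HasOrthogonalProjection := by
  have : CompleteSpace (bergmanSpace Ω μ) :=
    (isClosed_bergmanSpace hΩ hμ hpos).completeSpace_coe
  infer_instance

end General

/-- The Hartogs triangle `{(z₁, z₂) : |z₁| < |z₂| < 1}`. -/
def hartogsTriangle : Set (ℂ × ℂ) := {z | ‖z.1‖ < ‖z.2‖ ∧ ‖z.2‖ < 1}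

/-- The weight `μ(z) = |z₂| ^ s`. -/
noncomputable def hartogsWeight (s : ℝ) (z : ℂ × ℂ) : ℝ := ‖z.2‖ ^ s

instance hasOrthogonalProjection_hartogs (s : ℝ) :
    (bergmanSpace hartogsTriangle (hartogsWeight s)).HasOrthogonalProjection := by
  have hpos : ∀ z ∈ hartogsTriangle, 0 < ‖z.2‖ := fun z hz => (norm_nonneg _).trans_lt hz.1
  have : (volume : Measure (ℂ × ℂ)).IsAddHaarMeasure :=
    inferInstanceAs ((volume : Measure ℂ).prod (volume : Measure ℂ)).IsAddHaarMeasure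
  refine hasOrthogonalProjection_bergmanSpace ?_ ?_ ?_
  · have h1 : IsOpen {z : ℂ × ℂ | ‖z.1‖ < ‖z.2‖} := isOpen_lt (by fun_prop) (by fun_prop)
    have h2 : IsOpen {z : ℂ × ℂ | ‖z.2‖ < 1} := isOpen_lt (by fun_prop) (by fun_prop)
    exact h1.inter h2
  · exact ContinuousOn.rpow_const (by fun_prop) fun z hz => Or.inl (hpos z hz).ne'
  · exact fun z hz => Real.rpow_pos_of_pos (hpos z hz) s

/-!
In the coordinates `w = (z₁ / z₂, z₂)` the Hartogs triangle becomes the product of the disc and the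
punctured disc, carrying the measure `|w₂| ^ (-(q + 2)) dA dA` with `q = p₀`. Since `1 ≤ q < 2`, the
square integrable holomorphic functions there are those divisible by `w₂`, so the projection is
given by an explicit product kernel. For `q < p ≤ 2` this kernel passes Schur's test, the
Forelli-Rudin estimates providing the test function; as the projection is self-adjoint, it is
bounded for an exponent exactly when it is bounded for the conjugate one. If `p ≤ q`, the function
`z₂ |z₂| ^ (q / p)` lies in `L²` and `L^p`, but its projection is a nonzero multiple of `z₂`, which
is not in `L^p`.
-/

open scoped ComplexConjugate

section Polar

theorem preimage_circleMap_ball_inter (R : ℝ) :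
    (fun x : ℝ × ℝ => circleMap 0 x.1 x.2) ⁻¹' ball 0 R ∩ polarCoord.target =
      Ioo 0 R ×ˢ Ioo (-Real.pi) Real.pi := by
  ext ⟨r, θ⟩
  simp only [polarCoord_target, mem_inter_iff, mem_preimage, mem_ball_zero_iff, norm_circleMap_zero,
    mem_prod, mem_Ioi, mem_Ioo]
  constructor
  · rintro ⟨h, hr, hθ⟩
    exact ⟨⟨hr, (le_abs_self r).trans_lt h⟩, hθ⟩
  · rintro ⟨⟨hr, h⟩, hθ⟩
    exact ⟨by rwa [abs_of_pos hr], hr, hθ⟩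

/-- The measure `r dr` on the interval `(0, R)`, the radial part of Lebesgue measure on the disc of
radius `R` in polar coordinates. -/
noncomputable def radialMeasure (R : ℝ) : Measure ℝ :=
  (volume.restrict (Ioo 0 R)).withDensity ENNReal.ofReal

instance sFinite_radialMeasure (R : ℝ) : SFinite (radialMeasure R) := by
  unfold radialMeasure
  infer_instance

theorem lintegral_radialMeasure (R : ℝ) (g : ℝ → ℝ≥0∞) :
    ∫⁻ r, g r ∂radialMeasure R = ∫⁻ r in Ioo 0 R, ENNReal.ofReal r * g r :=
  lintegral_withDensity_eq_lintegral_mul_non_measurable _ ENNReal.measurable_ofReal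
    (Eventually.of_forall fun _ => ENNReal.ofReal_lt_top) g

theorem measurePreserving_circleMap (R : ℝ) :
    MeasurePreserving (fun x : ℝ × ℝ => circleMap 0 x.1 x.2)
      ((radialMeasure R).prod (volume.restrict (Ioo (-Real.pi) Real.pi)))
      (volume.restrict (ball 0 R)) := by
  have hc : Measurable fun x : ℝ × ℝ => circleMap 0 x.1 x.2 :=
    Continuous.measurable (by unfold circleMap; fun_prop)
  have hpolar : ∀ x : ℝ × ℝ, Complex.polarCoord.symm x = circleMap 0 x.1 x.2 := fun x => by
    simp [Complex.polarCoord_symm_apply, circleMap, Complex.exp_mul_I]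
  refine ⟨hc, Measure.ext_of_lintegral _ fun f hf => ?_⟩
  have hind : ∀ x : ℝ × ℝ, ENNReal.ofReal x.1 * (ball (0 : ℂ) R).indicator f (circleMap 0 x.1 x.2) =
      ((fun x : ℝ × ℝ => circleMap 0 x.1 x.2) ⁻¹' ball 0 R).indicator
        (fun x => ENNReal.ofReal x.1 * f (circleMap 0 x.1 x.2)) x := fun x => by
    by_cases hx : circleMap 0 x.1 x.2 ∈ ball 0 R <;> simp [indicator, hx]
  calc ∫⁻ z, f z ∂Measure.map _ ((radialMeasure R).prod (volume.restrict (Ioo (-Real.pi) Real.pi)))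
      = ∫⁻ x in Ioo 0 R ×ˢ Ioo (-Real.pi) Real.pi,
          ENNReal.ofReal x.1 * f (circleMap 0 x.1 x.2) := by
        rw [lintegral_map hf hc, radialMeasure, prod_withDensity_left ENNReal.measurable_ofReal,
          Measure.prod_restrict, ← Measure.volume_eq_prod]
        exact lintegral_withDensity_eq_lintegral_mul _ (by fun_prop) (hf.comp hc)
    _ = ∫⁻ x in polarCoord.target,
          ENNReal.ofReal x.1 • (ball (0 : ℂ) R).indicator f (Complex.polarCoord.symm x) := by
        simp_rw [hpolar, smul_eq_mul, hind]
        rw [setLIntegral_indicator (hc measurableSet_ball), preimage_circleMap_ball_inter]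
    _ = ∫⁻ z in ball 0 R, f z := by
        rw [Complex.lintegral_comp_polarCoord_symm, lintegral_indicator measurableSet_ball]

theorem lintegral_ball_eq_polar {f : ℂ → ℝ≥0∞} (hf : Measurable f) (R : ℝ) :
    ∫⁻ z in ball 0 R, f z = ∫⁻ r in Ioo 0 R, ENNReal.ofReal r *
      ∫⁻ θ in Ioo (-Real.pi) Real.pi, f (circleMap 0 r θ) := by
  have hP := measurePreserving_circleMap R
  rw [← lintegral_radialMeasure, ← hP.lintegral_comp hf]
  exact lintegral_prod _ (hf.comp hP.measurable).aemeasurable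

variable {F : Type*} [NormedAddCommGroup F] [NormedSpace ℝ F]

theorem two_pi_smul_circleAverage (f : ℂ → F) (r : ℝ) :
    (2 * Real.pi) • Real.circleAverage f 0 r =
      ∫ θ in Ioo (-Real.pi) Real.pi, f (circleMap 0 r θ) := by
  rw [Real.circleAverage_eq_integral_add (-Real.pi),
    intervalIntegral.integral_comp_add_right fun θ => f (circleMap 0 r θ), smul_smul,
    mul_inv_cancel₀ (by positivity), one_smul, zero_add, two_mul, add_neg_cancel_right,
    intervalIntegral.integral_of_le (by linarith [Real.pi_pos]), integral_Ioc_eq_integral_Ioo]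

theorem ofReal_toReal_smul_integral_circleMap {R r : ℝ} (hr : r ∈ Ioo 0 R) (f : ℂ → F) :
    (ENNReal.ofReal r).toReal • ∫ θ in Ioo (-Real.pi) Real.pi, f (circleMap 0 r θ) =
      (2 * Real.pi * r) • Real.circleAverage f 0 r := by
  rw [ENNReal.toReal_ofReal hr.1.le, mul_comm, mul_smul, two_pi_smul_circleAverage]

theorem integrableOn_smul_circleAverage {f : ℂ → F} {R : ℝ} (hf : IntegrableOn f (ball 0 R)) :
    IntegrableOn (fun r => (2 * Real.pi * r) • Real.circleAverage f 0 r) (Ioo 0 R) := by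
  have h := ((measurePreserving_circleMap R).integrable_comp_of_integrable hf).integral_prod_left
  rw [radialMeasure, integrable_withDensity_iff_integrable_smul' ENNReal.measurable_ofReal
    (Eventually.of_forall fun _ => ENNReal.ofReal_lt_top)] at h
  exact h.congr (ae_restrict_of_forall_mem measurableSet_Ioo fun r hr =>
    ofReal_toReal_smul_integral_circleMap hr f)

theorem integral_ball_eq_circleAverage {f : ℂ → F} {R : ℝ} (hf : IntegrableOn f (ball 0 R)) :
    ∫ z in ball 0 R, f z = ∫ r in Ioo 0 R, (2 * Real.pi * r) • Real.circleAverage f 0 r := by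
  have hP := measurePreserving_circleMap R
  calc ∫ z in ball 0 R, f z
      = ∫ x, f (circleMap 0 x.1 x.2)
          ∂(radialMeasure R).prod (volume.restrict (Ioo (-Real.pi) Real.pi)) := by
        rw [← hP.map_eq]
        exact integral_map hP.aemeasurable (by rw [hP.map_eq]; exact hf.aestronglyMeasurable)
    _ = ∫ r, (∫ θ in Ioo (-Real.pi) Real.pi, f (circleMap 0 r θ)) ∂radialMeasure R :=
        integral_prod _ (hP.integrable_comp_of_integrable hf)
    _ = _ := by
        rw [radialMeasure, integral_withDensity_eq_integral_toReal_smul ENNReal.measurable_ofReal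
          (Eventually.of_forall fun _ => ENNReal.ofReal_lt_top)]
        exact setIntegral_congr_fun measurableSet_Ioo fun r hr =>
          ofReal_toReal_smul_integral_circleMap hr f

end Polar

section DiskKernel

/-- The Bergman kernel of the unit disc with weight `|η| ^ (-q)`, as a function of `t = w * conj η`.
It is the sum of the series `∑ (2 n + 2 - q) / (2 π) * t ^ n`. -/
noncomputable def diskKernel (q : ℝ) (t : ℂ) : ℂ :=
  (2 * Real.pi : ℂ)⁻¹ * (2 / (1 - t) ^ 2 - q / (1 - t))

theorem conj_diskKernel (q : ℝ) (t : ℂ) : conj (diskKernel q t) = diskKernel q (conj t) := by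
  simp [diskKernel, map_ofNat]

theorem norm_mul_conj_lt_one {w η : ℂ} (hw : ‖w‖ < 1) (hη : ‖η‖ < 1) : ‖w * conj η‖ < 1 := by
  rw [norm_mul, RCLike.norm_conj]
  exact mul_lt_one_of_nonneg_of_lt_one_left (norm_nonneg w) hw hη.le

theorem one_sub_ne_zero_of_norm_lt_one {t : ℂ} (ht : ‖t‖ < 1) : 1 - t ≠ 0 :=
  sub_ne_zero.2 fun h => by simp [← h] at ht

theorem differentiableOn_diskKernel (q : ℝ) : DifferentiableOn ℂ (diskKernel q) (ball 0 1) := by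
  have hne : ∀ t ∈ ball (0 : ℂ) 1, 1 - t ≠ 0 := fun t ht =>
    one_sub_ne_zero_of_norm_lt_one (by simpa using ht)
  unfold diskKernel
  exact (((differentiableOn_const _).div (by fun_prop) fun t ht => pow_ne_zero 2 (hne t ht)).sub
    ((differentiableOn_const _).div (by fun_prop) hne)).const_mul _

theorem measurable_diskKernel (q : ℝ) : Measurable (diskKernel q) := by
  unfold diskKernel
  fun_prop

theorem norm_diskKernel_le (q : ℝ) {t : ℂ} (ht : ‖t‖ < 1) :
    ‖diskKernel q t‖ ≤ (1 + |q|) * (‖1 - t‖ ^ 2)⁻¹ := by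
  have h0 := one_sub_ne_zero_of_norm_lt_one ht
  have hle : ‖1 - t‖ ≤ 2 := (norm_sub_le _ _).trans (by rw [norm_one]; linarith)
  have hnum : ‖2 - q * (1 - t)‖ ≤ 2 * (1 + |q|) := by
    refine (norm_sub_le _ _).trans ?_
    rw [norm_mul, Complex.norm_real, Real.norm_eq_abs, Complex.norm_ofNat]
    nlinarith [abs_nonneg q]
  have hpi : (2 * Real.pi)⁻¹ ≤ 1 / 2 := by
    rw [← one_div]
    gcongr
    linarith [Real.pi_gt_three]
  have heq : diskKernel q t =
      ((2 * Real.pi)⁻¹ : ℝ) * ((2 - q * (1 - t)) * ((1 - t) ^ 2)⁻¹) := by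
    rw [diskKernel]
    push_cast
    field_simp
  rw [heq, norm_mul, norm_mul, norm_inv, norm_pow, Complex.norm_real, Real.norm_eq_abs,
    abs_of_pos (by positivity)]
  calc _ ≤ 1 / 2 * (2 * (1 + |q|) * (‖1 - t‖ ^ 2)⁻¹) := by gcongr
    _ = _ := by ring

theorem mul_conj_eq_div_of_mem_sphere (w : ℂ) {η : ℂ} {r : ℝ} (hr : r ≠ 0)
    (hη : η ∈ sphere (0 : ℂ) r) : w * conj η = w * r ^ 2 / η := by
  have hη0 : η ≠ 0 := by
    rintro rfl
    simp [hr.symm] at hη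
  rw [eq_div_iff hη0, mul_assoc, mul_comm (conj η), Complex.mul_conj',
    mem_sphere_zero_iff_norm.1 hη]

theorem circleAverage_sq_div_sub_mul {f : ℂ → ℂ} {U : Set ℂ} (hU : IsOpen U) {r : ℝ} (hr : 0 < r)
    (hrU : closedBall 0 r ⊆ U) (hf : DifferentiableOn ℂ f U) {u : ℂ} (hu : u ∈ ball (0 : ℂ) r) :
    Real.circleAverage (fun η => (η / (η - u)) ^ 2 * f η) 0 r = u * deriv f u + f u := by
  have hfu : DifferentiableAt ℂ f u :=
    hf.differentiableAt (hU.mem_nhds (hrU (ball_subset_closedBall hu)))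
  have hderiv : deriv (fun η => η * f η) u = u * deriv f u + f u := by
    rw [deriv_fun_mul differentiableAt_fun_id hfu, deriv_id'']
    ring
  have hg : DifferentiableOn ℂ (fun η => η * f η) U := differentiableOn_id.mul hf
  rw [← hderiv, Real.circleAverage_eq_circleIntegral hr.ne',
    ← Complex.two_pi_I_inv_smul_circleIntegral_sub_sq_inv_smul_of_differentiable hU hrU hg hu]
  congr 1
  refine circleIntegral.integral_congr hr.le fun η hη => ?_
  have hη0 : η ≠ 0 := by
    rintro rfl
    simp [hr.ne] at hη
  simp only [smul_eq_mul, sub_zero]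
  field_simp

theorem mul_sq_mem_ball {w : ℂ} (hw : w ∈ ball (0 : ℂ) 1) {r : ℝ} (hr : r ∈ Ioc (0 : ℝ) 1) :
    w * r ^ 2 ∈ ball (0 : ℂ) r := by
  have hw1 : ‖w‖ < 1 := by simpa using hw
  rw [mem_ball_zero_iff, norm_mul, norm_pow, Complex.norm_real, Real.norm_eq_abs, abs_of_pos hr.1]
  nlinarith [norm_nonneg w, hr.1, hr.2, mul_pos hr.1 hr.1]

theorem circleAverage_diskKernel_mul (q : ℝ) {h : ℂ → ℂ} (hh : DifferentiableOn ℂ h (ball 0 1))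
    {w : ℂ} (hw : w ∈ ball (0 : ℂ) 1) {r : ℝ} (hr : r ∈ Ioo (0 : ℝ) 1) :
    Real.circleAverage (fun η => diskKernel q (w * conj η) * h η) 0 r =
      (2 * Real.pi : ℂ)⁻¹ *
        (2 * (w * r ^ 2) * deriv h (w * r ^ 2) + (2 - q) * h (w * r ^ 2)) := by
  have hu := mul_sq_mem_ball hw (Ioo_subset_Ioc_self hr)
  set u : ℂ := w * r ^ 2
  have hne : ∀ η ∈ sphere (0 : ℂ) r, η ≠ 0 ∧ η - u ≠ 0 := fun η hη =>
    ⟨ne_of_mem_of_not_mem hη (by simp [hr.1.ne]),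
      sub_ne_zero.2 (ne_of_mem_of_not_mem hη (by simpa using (mem_ball_zero_iff.1 hu).ne))⟩
  have hsub : closedBall (0 : ℂ) r ⊆ ball 0 1 := closedBall_subset_ball hr.2
  have hcont : ContinuousOn h (sphere 0 r) :=
    hh.continuousOn.mono (sphere_subset_closedBall.trans hsub)
  have hdiv : ContinuousOn (fun η => η / (η - u)) (sphere 0 r) :=
    continuousOn_id.div (by fun_prop) fun η hη => (hne η hη).2
  have hav1 : Real.circleAverage (fun η => η / (η - u) * h η) 0 r = h u := by
    have hcl : DiffContOnCl ℂ h (ball 0 |r|) := by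
      rw [abs_of_pos hr.1]
      exact hh.diffContOnCl_ball hsub
    simpa using hcl.circleAverage_smul_div (w := u) (by rwa [abs_of_pos hr.1])
  have hav2 := circleAverage_sq_div_sub_mul isOpen_ball hr.1 hsub hh hu
  have heq : EqOn (fun η => diskKernel q (w * conj η) * h η) (fun η => (2 * Real.pi : ℂ)⁻¹ •
      ((2 : ℂ) • ((η / (η - u)) ^ 2 * h η) - (q : ℂ) • (η / (η - u) * h η))) (sphere 0 |r|) := by
    intro η hη
    rw [abs_of_pos hr.1] at hη
    obtain ⟨hη0, hηu⟩ := hne η hη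
    have hquot : w * conj η = u / η := mul_conj_eq_div_of_mem_sphere w hr.1.ne' hη
    have hsub_quot : 1 - u / η = (η - u) / η := by field_simp
    simp only [diskKernel, hquot, hsub_quot, smul_eq_mul]
    field_simp
  rw [Real.circleAverage_congr_sphere heq, Real.circleAverage_fun_smul,
    Real.circleAverage_fun_sub, Real.circleAverage_fun_smul, Real.circleAverage_fun_smul, hav1,
    hav2]
  · simp only [smul_eq_mul]
    ring
  · exact (((hdiv.pow 2).mul hcont).const_smul (2 : ℂ)).circleIntegrable hr.1.le
  · exact ((hdiv.mul hcont).const_smul (q : ℂ)).circleIntegrable hr.1.le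

theorem circleAverage_mul_radial (f : ℂ → ℂ) (ψ : ℝ → ℝ) {r : ℝ} (hr : 0 < r) :
    Real.circleAverage (fun η => f η * (ψ ‖η‖ : ℝ)) 0 r = ψ r * Real.circleAverage f 0 r := by
  rw [← smul_eq_mul (ψ r : ℂ), ← Real.circleAverage_fun_smul]
  refine Real.circleAverage_congr_sphere fun η hη => ?_
  rw [abs_of_pos hr, mem_sphere_zero_iff_norm] at hη
  simp only [hη, smul_eq_mul, mul_comm]

theorem hasDerivAt_rpow_mul_comp_mul_sq (q : ℝ) {h : ℂ → ℂ} {w : ℂ} {r : ℝ} (hr : 0 < r)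
    (hh : DifferentiableAt ℂ h (w * r ^ 2)) :
    HasDerivAt (fun x : ℝ => ((x ^ (2 - q) : ℝ) : ℂ) * h (w * x ^ 2))
      ((r ^ (1 - q) : ℝ) *
        (2 * (w * r ^ 2) * deriv h (w * r ^ 2) + (2 - q) * h (w * r ^ 2))) r := by
  have hsq : HasDerivAt (fun x : ℂ => w * x ^ 2) (w * (2 * r)) (r : ℂ) := by
    simpa using (hasDerivAt_pow 2 (r : ℂ)).const_mul w
  have hcomp : HasDerivAt (fun x : ℝ => h (w * x ^ 2)) (deriv h (w * r ^ 2) * (w * (2 * r))) r :=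
    (HasDerivAt.comp (r : ℂ) hh.hasDerivAt hsq).comp_ofReal
  have hpow : HasDerivAt (fun x : ℝ => ((x ^ (2 - q) : ℝ) : ℂ))
      (((2 - q) * r ^ (2 - q - 1) : ℝ) : ℂ) r :=
    (Real.hasDerivAt_rpow_const (Or.inl hr.ne')).ofReal_comp
  have hpow_pred : r ^ (2 - q - 1) = r ^ (1 - q) := by ring_nf
  have hpow_split : r ^ (2 - q) = r ^ (1 - q) * r := by
    rw [← Real.rpow_add_one hr.ne']
    ring_nf
  refine (hpow.mul hcomp).congr_deriv ?_
  rw [hpow_pred, hpow_split]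
  push_cast
  ring

theorem integral_diskKernel_mul {q : ℝ} (hq : q < 2) {h : ℂ → ℂ}
    (hh : DifferentiableOn ℂ h (ball 0 1)) {w : ℂ} (hw : w ∈ ball (0 : ℂ) 1)
    (hint : IntegrableOn (fun η => diskKernel q (w * conj η) * h η * (‖η‖ ^ (-q) : ℝ))
      (ball 0 1)) :
    ∫ η in ball (0 : ℂ) 1, diskKernel q (w * conj η) * h η * (‖η‖ ^ (-q) : ℝ) = h w := by
  have hcircle : ∀ r ∈ Ioo (0 : ℝ) 1, (2 * Real.pi * r) • Real.circleAverage
      (fun η => diskKernel q (w * conj η) * h η * (‖η‖ ^ (-q) : ℝ)) 0 r =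
      (r ^ (1 - q) : ℝ) * (2 * (w * r ^ 2) * deriv h (w * r ^ 2) + (2 - q) * h (w * r ^ 2)) := by
    intro r hr
    rw [circleAverage_mul_radial _ (fun s => s ^ (-q)) hr.1,
      circleAverage_diskKernel_mul q hh hw hr,
      sub_eq_add_neg (1 : ℝ), Real.rpow_add hr.1, Real.rpow_one, Complex.real_smul]
    have := Real.pi_ne_zero
    push_cast
    field_simp
  have hmem : ∀ r ∈ Icc (0 : ℝ) 1, w * r ^ 2 ∈ ball (0 : ℂ) 1 := fun r hr => by
    rcases hr.1.eq_or_lt with rfl | h0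
    · simp
    · exact ball_subset_ball hr.2 (mul_sq_mem_ball hw ⟨h0, hr.2⟩)
  have hcont : ContinuousOn (fun r : ℝ => ((r ^ (2 - q) : ℝ) : ℂ) * h (w * r ^ 2)) (Icc 0 1) :=
    (Complex.continuous_ofReal.comp_continuousOn
      (continuousOn_id.rpow_const fun _ _ => Or.inr (by linarith))).mul
      (hh.continuousOn.comp (by fun_prop) fun r hr => hmem r hr)
  have hderiv := fun r (hr : r ∈ Ioo (0 : ℝ) 1) => hasDerivAt_rpow_mul_comp_mul_sq q hr.1
    (hh.differentiableAt (isOpen_ball.mem_nhds (hmem r (Ioo_subset_Icc_self hr))))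
  rw [integral_ball_eq_circleAverage hint, setIntegral_congr_fun measurableSet_Ioo hcircle,
    ← integral_Ioc_eq_integral_Ioo, ← intervalIntegral.integral_of_le zero_le_one,
    intervalIntegral.integral_eq_sub_of_hasDerivAt_of_le zero_le_one hcont hderiv]
  · simp [Real.zero_rpow (by linarith : 2 - q ≠ 0)]
  · rw [intervalIntegrable_iff_integrableOn_Ioo_of_le zero_le_one]
    exact (integrableOn_smul_circleAverage hint).congr_fun hcircle measurableSet_Ioo

theorem integral_diskKernel_mul_radial (q : ℝ) {ψ : ℝ → ℝ} {w : ℂ} (hw : w ∈ ball (0 : ℂ) 1)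
    (hint : IntegrableOn (fun η => diskKernel q (w * conj η) * (ψ ‖η‖ : ℝ)) (ball 0 1)) :
    ∫ η in ball (0 : ℂ) 1, diskKernel q (w * conj η) * (ψ ‖η‖ : ℝ) =
      ((2 - q) * ∫ r in Ioo (0 : ℝ) 1, r * ψ r : ℝ) := by
  rw [integral_ball_eq_circleAverage hint, ← integral_const_mul, ← integral_complex_ofReal]
  refine setIntegral_congr_fun measurableSet_Ioo fun r hr => ?_
  have hav := circleAverage_diskKernel_mul q (h := fun _ => 1) (differentiableOn_const _) hw hr
  simp only [mul_one, deriv_const, mul_zero, zero_add] at hav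
  simp only [circleAverage_mul_radial _ ψ hr.1, hav, Complex.real_smul]
  have := Real.pi_ne_zero
  push_cast
  field_simp

end DiskKernel

section ForelliRudin

theorem integrableOn_rpow_div_one_add {α : ℝ} (hα0 : 0 < α) (hα1 : α < 1) :
    IntegrableOn (fun u : ℝ => u ^ (-α) / (1 + u)) (Ioi 0) := by
  have hm : ∀ s : Set ℝ, AEStronglyMeasurable (fun u : ℝ => u ^ (-α) / (1 + u))
      (volume.restrict s) := fun s =>
    ((measurable_id.pow_const _).div (measurable_const.add measurable_id)).aestronglyMeasurable
  have hnear : IntegrableOn (fun u : ℝ => u ^ (-α)) (Ioc 0 1) := by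
    rw [integrableOn_Ioc_iff_integrableOn_Ioo, intervalIntegral.integrableOn_Ioo_rpow_iff one_pos]
    linarith
  have hfar : IntegrableOn (fun u : ℝ => u ^ (-α - 1)) (Ioi 1) :=
    integrableOn_Ioi_rpow_of_lt (by linarith) one_pos
  rw [← Ioc_union_Ioi_eq_Ioi zero_le_one]
  refine IntegrableOn.union
    (hnear.mono' (hm _) (ae_restrict_of_forall_mem measurableSet_Ioc fun u hu => ?_))
    (hfar.mono' (hm _) (ae_restrict_of_forall_mem measurableSet_Ioi fun u hu => ?_))
  · have := Real.rpow_nonneg hu.1.le (-α)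
    rw [Real.norm_of_nonneg (div_nonneg this (by linarith [hu.1]))]
    exact div_le_self this (by linarith [hu.1])
  · have hu0 : 0 < u := one_pos.trans hu
    rw [Real.norm_of_nonneg (by positivity), Real.rpow_sub_one hu0.ne']
    gcongr
    linarith

theorem integral_rpow_div_add {α δ : ℝ} (hδ : 0 < δ) :
    ∫ s in Ioi (0 : ℝ), s ^ (-α) / (δ + s) =
      δ ^ (-α) * ∫ u in Ioi (0 : ℝ), u ^ (-α) / (1 + u) := by
  have hscale : ∀ u ∈ Ioi (0 : ℝ),
      δ * ((δ * u) ^ (-α) / (δ + δ * u)) = δ ^ (-α) * (u ^ (-α) / (1 + u)) := fun u hu => by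
    rw [Real.mul_rpow hδ.le (le_of_lt hu)]
    field_simp
  rw [← integral_const_mul, ← setIntegral_congr_fun measurableSet_Ioi hscale, integral_const_mul,
    integral_comp_mul_left_Ioi (fun s => s ^ (-α) / (δ + s)) 0 hδ, mul_zero, smul_eq_mul,
    mul_inv_cancel_left₀ hδ.ne']

theorem exists_lintegral_rpow_div_add_le {α : ℝ} (hα0 : 0 < α) (hα1 : α < 1) :
    ∃ C : ℝ≥0, ∀ δ > 0, ∫⁻ s in Ioo (0 : ℝ) 1, ENNReal.ofReal (s ^ (-α) / (δ + s)) ≤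
      C * ENNReal.ofReal (δ ^ (-α)) := by
  refine ⟨Real.toNNReal (∫ u in Ioi (0 : ℝ), u ^ (-α) / (1 + u)), fun δ hδ => ?_⟩
  have hint : IntegrableOn (fun s : ℝ => s ^ (-α) / (δ + s)) (Ioi 0) := by
    rw [← mul_zero δ, ← integrableOn_Ioi_comp_mul_left_iff _ _ hδ]
    have hscaled : IntegrableOn (fun u : ℝ => δ ^ (-α) * δ⁻¹ * (u ^ (-α) / (1 + u))) (Ioi 0) :=
      (integrableOn_rpow_div_one_add hα0 hα1).const_mul _
    refine hscaled.congr_fun (fun u hu => ?_) measurableSet_Ioi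
    simp only [Real.mul_rpow hδ.le (le_of_lt (mem_Ioi.1 hu))]
    field_simp
  have hnonneg : ∀ s ∈ Ioi (0 : ℝ), 0 ≤ s ^ (-α) / (δ + s) := fun s hs => by
    have : 0 < s := hs
    positivity
  calc ∫⁻ s in Ioo (0 : ℝ) 1, ENNReal.ofReal (s ^ (-α) / (δ + s))
      ≤ ∫⁻ s in Ioi (0 : ℝ), ENNReal.ofReal (s ^ (-α) / (δ + s)) :=
        lintegral_mono_set Ioo_subset_Ioi_self
    _ = ENNReal.ofReal (δ ^ (-α) * ∫ u in Ioi (0 : ℝ), u ^ (-α) / (1 + u)) := by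
        rw [← integral_rpow_div_add hδ, ofReal_integral_eq_lintegral_ofReal hint
          (ae_restrict_of_forall_mem measurableSet_Ioi hnonneg)]
    _ = _ := by rw [ENNReal.ofReal_mul (by positivity), mul_comm, ENNReal.ofReal.eq_1 (∫ _ in _, _)]

theorem rpow_mul_one_sub_rpow_div_le {α x r : ℝ} (γ : ℝ) (hα0 : 0 ≤ α) (hα1 : α ≤ 1)
    (hx : x ∈ Ico (0 : ℝ) 1) (hr : r ∈ Ioo (0 : ℝ) 1) :
    r ^ γ * (1 - r) ^ (-α) / (1 - x * r) ≤
      4 * r ^ γ + 2 * 2 ^ |γ| * ((1 - r) ^ (-α) / (1 - x + (1 - r))) := by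
  obtain ⟨hx0, hx1⟩ := hx
  obtain ⟨hr0, hr1⟩ := hr
  have : 0 < 1 - r := by linarith
  have : 0 < 1 - x := by linarith
  have : 0 < 1 - x * r := by nlinarith
  have half_rpow_neg : ∀ a : ℝ, (1 / 2 : ℝ) ^ (-a) = 2 ^ a := fun a => by
    rw [one_div, Real.inv_rpow zero_le_two, Real.rpow_neg zero_le_two, inv_inv]
  rcases le_total r (1 / 2) with h | h
  · have hpow : (1 - r) ^ (-α) ≤ 2 := by
      calc (1 - r) ^ (-α) ≤ (1 / 2 : ℝ) ^ (-α) :=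
            Real.rpow_le_rpow_of_nonpos (by norm_num) (by linarith) (by linarith)
        _ = 2 ^ α := half_rpow_neg α
        _ ≤ 2 ^ (1 : ℝ) := Real.rpow_le_rpow_of_exponent_le one_le_two hα1
        _ = 2 := Real.rpow_one _
    have hden : 1 / 2 ≤ 1 - x * r := by nlinarith
    calc r ^ γ * (1 - r) ^ (-α) / (1 - x * r) ≤ r ^ γ * 2 / (1 / 2) := by gcongr
      _ = 4 * r ^ γ := by ring
      _ ≤ _ := le_add_of_nonneg_right (by positivity)
  · have hpow : r ^ γ ≤ 2 ^ |γ| := by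
      calc r ^ γ ≤ r ^ (-|γ|) := Real.rpow_le_rpow_of_exponent_ge hr0 hr1.le (neg_abs_le γ)
        _ ≤ (1 / 2 : ℝ) ^ (-|γ|) :=
            Real.rpow_le_rpow_of_nonpos (by norm_num) h (neg_nonpos.2 (abs_nonneg γ))
        _ = 2 ^ |γ| := half_rpow_neg _
    have hden : (1 - x + (1 - r)) / 2 ≤ 1 - x * r := by nlinarith
    calc r ^ γ * (1 - r) ^ (-α) / (1 - x * r)
        ≤ 2 ^ |γ| * (1 - r) ^ (-α) / ((1 - x + (1 - r)) / 2) := by gcongr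
      _ = 2 * 2 ^ |γ| * ((1 - r) ^ (-α) / (1 - x + (1 - r))) := by
        rw [div_div_eq_mul_div]
        ring
      _ ≤ _ := le_add_of_nonneg_left (by positivity)

theorem lintegral_Ioo_zero_one_comp_one_sub (f : ℝ → ℝ≥0∞) :
    ∫⁻ r in Ioo (0 : ℝ) 1, f (1 - r) = ∫⁻ s in Ioo (0 : ℝ) 1, f s := by
  have h := (Measure.measurePreserving_sub_left
    (volume : Measure ℝ) 1).setLIntegral_comp_preimage_emb
      (MeasurableEquiv.subLeft 1).measurableEmbedding f (Ioo 0 1)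
  simpa using h

theorem exists_lintegral_rpow_mul_one_sub_rpow_le {α γ : ℝ} (hα0 : 0 < α) (hα1 : α < 1)
    (hγ : -1 < γ) :
    ∃ C : ℝ≥0, ∀ x ∈ Ico (0 : ℝ) 1,
      ∫⁻ r in Ioo (0 : ℝ) 1, ENNReal.ofReal (r ^ γ * (1 - r) ^ (-α) / (1 - x * r)) ≤
        C * ENNReal.ofReal ((1 - x) ^ (-α)) := by
  obtain ⟨B, hB⟩ := exists_lintegral_rpow_div_add_le hα0 hα1
  obtain ⟨A, hA⟩ : ∃ A : ℝ≥0, ∫⁻ r in Ioo (0 : ℝ) 1, ENNReal.ofReal (r ^ γ) = A :=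
    ⟨_, (ENNReal.coe_toNNReal ((intervalIntegral.integrableOn_Ioo_rpow_iff
      one_pos).2 hγ).lintegral_lt_top.ne).symm⟩
  refine ⟨4 * A + Real.toNNReal (2 * 2 ^ |γ|) * B, fun x hx => ?_⟩
  have hone : 1 ≤ ENNReal.ofReal ((1 - x) ^ (-α)) := ENNReal.one_le_ofReal.2
    (Real.one_le_rpow_of_pos_of_le_one_of_nonpos (by linarith [hx.2]) (by linarith [hx.1])
      (by linarith))
  calc _ ≤ ∫⁻ r in Ioo (0 : ℝ) 1, (4 * ENNReal.ofReal (r ^ γ) + ENNReal.ofReal (2 * 2 ^ |γ|) *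
        ENNReal.ofReal ((1 - r) ^ (-α) / (1 - x + (1 - r)))) := by
        refine setLIntegral_mono (by fun_prop) fun r hr => ?_
        have := Real.rpow_nonneg hr.1.le γ
        have := Real.rpow_nonneg (sub_pos.2 hr.2).le (-α)
        have : 0 < 1 - x + (1 - r) := by linarith [hx.2, hr.2]
        rw [← ENNReal.ofReal_ofNat 4, ← ENNReal.ofReal_mul (by norm_num),
          ← ENNReal.ofReal_mul (by positivity),
          ← ENNReal.ofReal_add (by positivity) (by positivity)]
        exact ENNReal.ofReal_le_ofReal (rpow_mul_one_sub_rpow_div_le γ hα0.le hα1.le hx hr)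
    _ = 4 * A + ENNReal.ofReal (2 * 2 ^ |γ|) *
        ∫⁻ s in Ioo (0 : ℝ) 1, ENNReal.ofReal (s ^ (-α) / (1 - x + s)) := by
        rw [lintegral_add_left (by fun_prop), lintegral_const_mul _ (by fun_prop),
          lintegral_const_mul _ (by fun_prop), hA, lintegral_Ioo_zero_one_comp_one_sub fun s =>
            ENNReal.ofReal (s ^ (-α) / (1 - x + s))]
    _ ≤ 4 * A * ENNReal.ofReal ((1 - x) ^ (-α)) +
        ENNReal.ofReal (2 * 2 ^ |γ|) * (B * ENNReal.ofReal ((1 - x) ^ (-α))) := by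
        refine add_le_add (le_mul_of_one_le_right' hone) ?_
        gcongr
        exact hB _ (by linarith [hx.2])
    _ = _ := by
        rw [← mul_assoc, ← add_mul]
        push_cast
        rfl

theorem one_sub_norm_mul_pos {w : ℂ} (hw : w ∈ ball (0 : ℂ) 1) {r : ℝ} (hr : r ∈ Ioc (0 : ℝ) 1) :
    0 < 1 - ‖w‖ * r :=
  sub_pos.2 (mul_lt_one_of_nonneg_of_lt_one_left (norm_nonneg w) (by simpa using hw) hr.2)

theorem circleAverage_inv_norm_one_sub_sq {w : ℂ} (hw : w ∈ ball (0 : ℂ) 1) {r : ℝ}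
    (hr : r ∈ Ioc (0 : ℝ) 1) :
    Real.circleAverage (fun η => (‖1 - w * conj η‖ ^ 2)⁻¹) 0 r = (1 - (‖w‖ * r) ^ 2)⁻¹ := by
  set u : ℂ := w * r ^ 2
  have hwr := one_sub_norm_mul_pos hw hr
  have hpos : 1 - (‖w‖ * r) ^ 2 ≠ 0 := by nlinarith [mul_nonneg (norm_nonneg w) hr.1.le]
  have hpoisson : Real.circleAverage (poissonKernel 0 u • fun _ => (1 : ℝ)) 0 r = 1 :=
    (InnerProductSpace.harmonicContOnCl_const
      (s := ball (0 : ℂ) r)).circleAverage_poissonKernel_smul (mul_sq_mem_ball hw hr)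
  have heq : EqOn (fun η => (‖1 - w * conj η‖ ^ 2)⁻¹)
      (fun η => (1 - (‖w‖ * r) ^ 2)⁻¹ • (poissonKernel 0 u • fun _ => (1 : ℝ)) η)
      (sphere 0 |r|) := by
    intro η hη
    rw [abs_of_pos hr.1] at hη
    have hη' : ‖η‖ = r := mem_sphere_zero_iff_norm.1 hη
    have hη0 : η ≠ 0 := norm_pos_iff.1 (hη'.symm ▸ hr.1)
    have hquot : 1 - w * conj η = (η - u) / η := by
      rw [mul_conj_eq_div_of_mem_sphere w hr.1.ne' hη, sub_div, div_self hη0]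
    have hnum : r ^ 2 - (‖w‖ * r ^ 2) ^ 2 = (1 - (‖w‖ * r) ^ 2) * r ^ 2 := by ring
    have hnorm_u : ‖u‖ = ‖w‖ * r ^ 2 := by simp [u]
    simp only [Pi.smul_apply', poissonKernel_def, hquot, norm_div, hη', sub_zero, hnorm_u,
      smul_eq_mul, mul_one, hnum, mul_div_assoc, inv_mul_cancel_left₀ hpos, div_pow, inv_div]
  rw [Real.circleAverage_congr_sphere heq, Real.circleAverage_fun_smul, hpoisson, smul_eq_mul,
    mul_one]

theorem lintegral_inv_norm_one_sub_sq_circleMap {w : ℂ} (hw : w ∈ ball (0 : ℂ) 1) {r : ℝ}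
    (hr : r ∈ Ioo (0 : ℝ) 1) :
    ∫⁻ θ in Ioo (-Real.pi) Real.pi, ENNReal.ofReal ((‖1 - w * conj (circleMap 0 r θ)‖ ^ 2)⁻¹) =
      ENNReal.ofReal (2 * Real.pi / (1 - (‖w‖ * r) ^ 2)) := by
  have hne : ∀ θ, ‖1 - w * conj (circleMap 0 r θ)‖ ^ 2 ≠ 0 := fun θ => by
    refine pow_ne_zero 2 (norm_ne_zero_iff.2 (one_sub_ne_zero_of_norm_lt_one
      (norm_mul_conj_lt_one (by simpa using hw) ?_)))
    simpa [abs_of_pos hr.1] using hr.2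
  have hcont : Continuous fun θ => (‖1 - w * conj (circleMap 0 r θ)‖ ^ 2)⁻¹ :=
    Continuous.inv₀ (by fun_prop) hne
  rw [← ofReal_integral_eq_lintegral_ofReal
    ((hcont.continuousOn.integrableOn_Icc).mono_set Ioo_subset_Icc_self)
    (Eventually.of_forall fun θ => by positivity),
    ← two_pi_smul_circleAverage fun η => (‖1 - w * conj η‖ ^ 2)⁻¹,
    circleAverage_inv_norm_one_sub_sq hw (Ioo_subset_Ioc_self hr), smul_eq_mul, div_eq_mul_inv]

theorem lintegral_circleMap_forelliRudin_le {α κ : ℝ} {w : ℂ} (hw : w ∈ ball (0 : ℂ) 1) {r : ℝ}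
    (hr : r ∈ Ioo (0 : ℝ) 1) :
    ENNReal.ofReal r * ∫⁻ θ in Ioo (-Real.pi) Real.pi,
      ENNReal.ofReal (‖circleMap 0 r θ‖ ^ κ * (1 - ‖circleMap 0 r θ‖) ^ (-α) *
        (‖1 - w * conj (circleMap 0 r θ)‖ ^ 2)⁻¹) ≤
      ENNReal.ofReal (2 * Real.pi) *
        ENNReal.ofReal (r ^ (κ + 1) * (1 - r) ^ (-α) / (1 - ‖w‖ * r)) := by
  have hwr := one_sub_norm_mul_pos hw (Ioo_subset_Ioc_self hr)
  have hwr0 : 0 ≤ ‖w‖ * r := mul_nonneg (norm_nonneg w) hr.1.le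
  have hκ := Real.rpow_pos_of_pos hr.1 κ
  have hα := Real.rpow_pos_of_pos (sub_pos.2 hr.2) (-α)
  have hsplit : ∀ θ, ENNReal.ofReal (‖circleMap 0 r θ‖ ^ κ * (1 - ‖circleMap 0 r θ‖) ^ (-α) *
        (‖1 - w * conj (circleMap 0 r θ)‖ ^ 2)⁻¹) = ENNReal.ofReal (r ^ κ * (1 - r) ^ (-α)) *
        ENNReal.ofReal ((‖1 - w * conj (circleMap 0 r θ)‖ ^ 2)⁻¹) := fun θ => by
    rw [norm_circleMap_zero, abs_of_pos hr.1, ENNReal.ofReal_mul (by positivity)]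
  simp_rw [hsplit]
  rw [lintegral_const_mul' _ _ ENNReal.ofReal_ne_top,
    lintegral_inv_norm_one_sub_sq_circleMap hw hr, ← ENNReal.ofReal_mul (by positivity),
    ← ENNReal.ofReal_mul hr.1.le, ← ENNReal.ofReal_mul (by positivity)]
  refine ENNReal.ofReal_le_ofReal ?_
  calc r * (r ^ κ * (1 - r) ^ (-α) * (2 * Real.pi / (1 - (‖w‖ * r) ^ 2)))
      ≤ r * (r ^ κ * (1 - r) ^ (-α) * (2 * Real.pi / (1 - ‖w‖ * r))) := by
        have := hr.1.le
        gcongr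
        nlinarith
    _ = _ := by
        rw [Real.rpow_add_one hr.1.ne']
        ring

theorem exists_lintegral_forelliRudin_le {α κ : ℝ} (hα0 : 0 < α) (hα1 : α < 1) (hκ : -2 < κ) :
    ∃ C : ℝ≥0, ∀ w ∈ ball (0 : ℂ) 1,
      ∫⁻ η in ball (0 : ℂ) 1,
        ENNReal.ofReal (‖η‖ ^ κ * (1 - ‖η‖) ^ (-α) * (‖1 - w * conj η‖ ^ 2)⁻¹) ≤
        C * ENNReal.ofReal ((1 - ‖w‖) ^ (-α)) := by
  obtain ⟨C, hC⟩ := exists_lintegral_rpow_mul_one_sub_rpow_le hα0 hα1 (γ := κ + 1) (by linarith)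
  refine ⟨Real.toNNReal (2 * Real.pi) * C, fun w hw => ?_⟩
  have : Measurable fun η : ℂ => ‖1 - w * conj η‖ := Continuous.measurable (by fun_prop)
  calc _ = _ := lintegral_ball_eq_polar (by fun_prop) 1
    _ ≤ ∫⁻ r in Ioo (0 : ℝ) 1, ENNReal.ofReal (2 * Real.pi) *
        ENNReal.ofReal (r ^ (κ + 1) * (1 - r) ^ (-α) / (1 - ‖w‖ * r)) :=
        setLIntegral_mono (by fun_prop) fun r hr => lintegral_circleMap_forelliRudin_le hw hr
    _ = ENNReal.ofReal (2 * Real.pi) * ∫⁻ r in Ioo (0 : ℝ) 1,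
        ENNReal.ofReal (r ^ (κ + 1) * (1 - r) ^ (-α) / (1 - ‖w‖ * r)) :=
        lintegral_const_mul' _ _ ENNReal.ofReal_ne_top
    _ ≤ ENNReal.ofReal (2 * Real.pi) * (C * ENNReal.ofReal ((1 - ‖w‖) ^ (-α))) := by
        gcongr
        exact hC _ ⟨norm_nonneg w, by simpa using hw⟩
    _ = _ := by rw [ENNReal.coe_mul, mul_assoc, ENNReal.ofReal]

end ForelliRudin

section Schur

variable {X Y : Type*} [MeasurableSpace X] [MeasurableSpace Y] {μ : Measure X} {ν : Measure Y}
  {p p' : ℝ}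

theorem lintegral_mul_rpow_le_of_weight (hpp : p.HolderConjugate p') {k h f : Y → ℝ≥0∞}
    (hk : Measurable k) (hh : Measurable h) (h0 : ∀ᵐ y ∂ν, h y ≠ 0) (ht : ∀ᵐ y ∂ν, h y ≠ ∞)
    (hf : AEMeasurable f ν) :
    (∫⁻ y, k y * f y ∂ν) ^ p ≤
      (∫⁻ y, k y * h y ^ p' ∂ν) ^ (p / p') * ∫⁻ y, k y * (h y ^ (-p) * f y ^ p) ∂ν := by
  have hp : 0 < p := hpp.pos
  have hp' : 0 < p' := hpp.symm.pos
  have hsplit : ∀ᵐ y ∂ν,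
      k y * f y = (k y ^ (1 / p') * h y) * (k y ^ (1 / p) * ((h y)⁻¹ * f y)) := by
    filter_upwards [h0, ht] with y hy0 hyt
    have hk_split : k y = k y ^ (1 / p') * k y ^ (1 / p) := by
      rw [← ENNReal.rpow_add_of_nonneg _ _ (by positivity) (by positivity), one_div, one_div,
        hpp.symm.inv_add_inv_eq_one, ENNReal.rpow_one]
    calc k y * f y = (k y ^ (1 / p') * k y ^ (1 / p)) * ((h y * (h y)⁻¹) * f y) := by
          rw [← hk_split, ENNReal.mul_inv_cancel hy0 hyt, one_mul]
      _ = _ := by ring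
  have hpow_left : ∀ y, (k y ^ (1 / p') * h y) ^ p' = k y * h y ^ p' := fun y => by
    rw [ENNReal.mul_rpow_of_nonneg _ _ hp'.le, ← ENNReal.rpow_mul, one_div_mul_cancel hp'.ne',
      ENNReal.rpow_one]
  have hpow_right : ∀ y, (k y ^ (1 / p) * ((h y)⁻¹ * f y)) ^ p = k y * (h y ^ (-p) * f y ^ p) :=
    fun y => by
      rw [ENNReal.mul_rpow_of_nonneg _ _ hp.le, ENNReal.mul_rpow_of_nonneg _ _ hp.le,
        ← ENNReal.rpow_mul, one_div_mul_cancel hp.ne', ENNReal.rpow_one, ENNReal.inv_rpow,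
        ENNReal.rpow_neg]
  have hHolder : ∫⁻ y, k y * f y ∂ν ≤ (∫⁻ y, k y * h y ^ p' ∂ν) ^ (1 / p') *
      (∫⁻ y, k y * (h y ^ (-p) * f y ^ p) ∂ν) ^ (1 / p) := by
    rw [lintegral_congr_ae hsplit]
    simp_rw [← hpow_left, ← hpow_right]
    exact ENNReal.lintegral_mul_le_Lp_mul_Lq ν hpp.symm ((hk.pow_const _).mul hh).aemeasurable
      ((hk.pow_const _).aemeasurable.mul (hh.inv.aemeasurable.mul hf))
  refine (ENNReal.rpow_le_rpow hHolder hp.le).trans_eq ?_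
  rw [ENNReal.mul_rpow_of_nonneg _ _ hp.le, ← ENNReal.rpow_mul, ← ENNReal.rpow_mul,
    one_div_mul_cancel hp.ne', ENNReal.rpow_one, one_div_mul_eq_div]

theorem lintegral_rpow_le_of_schur [SFinite μ] [SFinite ν] (hpp : p.HolderConjugate p')
    {K : X → Y → ℝ≥0∞} (hK : Measurable (Function.uncurry K))
    {g : X → ℝ≥0∞} (hg : Measurable g) {h : Y → ℝ≥0∞} (hh : Measurable h)
    (h0 : ∀ᵐ y ∂ν, h y ≠ 0) (ht : ∀ᵐ y ∂ν, h y ≠ ∞) {A B : ℝ≥0∞}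
    (hA : ∀ᵐ x ∂μ, ∫⁻ y, K x y * h y ^ p' ∂ν ≤ A * g x ^ p')
    (hB : ∀ᵐ y ∂ν, ∫⁻ x, K x y * g x ^ p ∂μ ≤ B * h y ^ p)
    {f : Y → ℝ≥0∞} (hf : AEMeasurable f ν) :
    ∫⁻ x, (∫⁻ y, K x y * f y ∂ν) ^ p ∂μ ≤ A ^ (p / p') * B * ∫⁻ y, f y ^ p ∂ν := by
  have hpp' : 0 ≤ p / p' := div_nonneg hpp.nonneg hpp.symm.nonneg
  have hKx : ∀ x, Measurable (K x) := fun x => hK.comp measurable_prodMk_left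
  have hφ : AEMeasurable (fun y => h y ^ (-p) * f y ^ p) ν :=
    (hh.pow_const _).aemeasurable.mul (hf.pow_const _)
  have hprod : AEMeasurable (fun z : X × Y => g z.1 ^ p * (K z.1 z.2 * (h z.2 ^ (-p) * f z.2 ^ p)))
      (μ.prod ν) :=
    ((hg.comp measurable_fst).pow_const _).aemeasurable.mul (hK.aemeasurable.mul hφ.comp_snd)
  calc ∫⁻ x, (∫⁻ y, K x y * f y ∂ν) ^ p ∂μ
      ≤ ∫⁻ x, A ^ (p / p') * ∫⁻ y, g x ^ p * (K x y * (h y ^ (-p) * f y ^ p)) ∂ν ∂μ := by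
        refine lintegral_mono_ae ?_
        filter_upwards [hA] with x hx
        calc (∫⁻ y, K x y * f y ∂ν) ^ p
            ≤ (A * g x ^ p') ^ (p / p') * ∫⁻ y, K x y * (h y ^ (-p) * f y ^ p) ∂ν :=
              (lintegral_mul_rpow_le_of_weight hpp (hKx x) hh h0 ht hf).trans (by gcongr)
          _ = A ^ (p / p') * (g x ^ p * ∫⁻ y, K x y * (h y ^ (-p) * f y ^ p) ∂ν) := by
              rw [ENNReal.mul_rpow_of_nonneg _ _ hpp', ← ENNReal.rpow_mul,
                mul_div_cancel₀ _ hpp.symm.ne_zero, mul_assoc]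
          _ = _ := by rw [← lintegral_const_mul'' _ (by exact (hKx x).aemeasurable.mul hφ)]
    _ = A ^ (p / p') * ∫⁻ y, ∫⁻ x, g x ^ p * (K x y * (h y ^ (-p) * f y ^ p)) ∂μ ∂ν := by
        rw [lintegral_const_mul'' _ hprod.lintegral_prod_right', lintegral_lintegral_swap hprod]
    _ ≤ A ^ (p / p') * ∫⁻ y, B * f y ^ p ∂ν := by
        gcongr 1
        refine lintegral_mono_ae ?_
        filter_upwards [hB, h0, ht] with y hy hy0 hyt
        calc ∫⁻ x, g x ^ p * (K x y * (h y ^ (-p) * f y ^ p)) ∂μ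
            = (∫⁻ x, K x y * g x ^ p ∂μ) * (h y ^ (-p) * f y ^ p) := by
              rw [← lintegral_mul_const _
                (by exact (hK.comp measurable_prodMk_right).mul (hg.pow_const _))]
              exact lintegral_congr fun x => by ring
          _ ≤ (B * h y ^ p) * (h y ^ (-p) * f y ^ p) := by gcongr
          _ = B * (h y ^ p * h y ^ (-p)) * f y ^ p := by ring
          _ = B * f y ^ p := by
              rw [← ENNReal.rpow_add _ _ hy0 hyt, add_neg_cancel, ENNReal.rpow_zero, mul_one]
    _ = _ := by rw [lintegral_const_mul'' _ (hf.pow_const _), mul_assoc]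

end Schur

section HartogsMap

theorem lintegral_weightedMeasure {E : Type*} [MeasureSpace E] {Ω : Set E} {μ : E → ℝ}
    (hμ : Measurable μ) {f : E → ℝ≥0∞} (hf : Measurable f) :
    ∫⁻ z, f z ∂weightedMeasure Ω μ = ∫⁻ z in Ω, ENNReal.ofReal (μ z) * f z :=
  lintegral_withDensity_eq_lintegral_mul _ hμ.ennreal_ofReal hf

/-- The measure `|η| ^ (-e) dA` on the unit disc. -/
noncomputable def diskMeasure (e : ℝ) : Measure ℂ :=
  weightedMeasure (ball (0 : ℂ) 1) fun η => ‖η‖ ^ (-e)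

/-- The product of `dA` and `|η| ^ (-(q + 2)) dA` on the bidisc: the pull-back under `hartogsMap` of
the measure with weight `|z₂| ^ (-(q + 4))` on the Hartogs triangle, the Jacobian contributing
`|z₂| ^ 2`. -/
noncomputable def bidiskMeasure (q : ℝ) : Measure (ℂ × ℂ) :=
  (diskMeasure 0).prod (diskMeasure (q + 2))

/-- The measure with weight `|z₂| ^ (-(q + 4))` on the Hartogs triangle. -/
noncomputable abbrev hartogsMeasure (q : ℝ) : Measure (ℂ × ℂ) :=
  weightedMeasure hartogsTriangle (hartogsWeight (-(q + 4)))

/-- The biholomorphism `(w₁, w₂) ↦ (w₁ w₂, w₂)` from the product of a disc and a punctured disc to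
the Hartogs triangle. -/
def hartogsMap (w : ℂ × ℂ) : ℂ × ℂ := (w.1 * w.2, w.2)

/-- The inverse `(z₁, z₂) ↦ (z₁ / z₂, z₂)` of `hartogsMap`, off the line `z₂ = 0`. -/
noncomputable def hartogsMapInv (z : ℂ × ℂ) : ℂ × ℂ := (z.1 / z.2, z.2)

instance sFinite_diskMeasure (e : ℝ) : SFinite (diskMeasure e) := by
  unfold diskMeasure weightedMeasure
  infer_instance

instance sFinite_bidiskMeasure (q : ℝ) : SFinite (bidiskMeasure q) := by
  unfold bidiskMeasure
  infer_instance

theorem lintegral_diskMeasure (e : ℝ) {f : ℂ → ℝ≥0∞} (hf : Measurable f) :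
    ∫⁻ η, f η ∂diskMeasure e = ∫⁻ η in ball (0 : ℂ) 1, ENNReal.ofReal (‖η‖ ^ (-e)) * f η :=
  lintegral_weightedMeasure (by fun_prop) hf

theorem integral_diskMeasure (e : ℝ) (f : ℂ → ℂ) :
    ∫ η, f η ∂diskMeasure e = ∫ η in ball (0 : ℂ) 1, f η * (‖η‖ ^ (-e) : ℝ) := by
  rw [diskMeasure, weightedMeasure, integral_withDensity_eq_integral_toReal_smul (by fun_prop)
    (Eventually.of_forall fun _ => ENNReal.ofReal_lt_top)]
  congr with η
  rw [ENNReal.toReal_ofReal (by positivity), Complex.real_smul, mul_comm]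

theorem integrable_diskMeasure_iff (e : ℝ) (f : ℂ → ℂ) :
    Integrable f (diskMeasure e) ↔ IntegrableOn (fun η => f η * (‖η‖ ^ (-e) : ℝ)) (ball 0 1) := by
  rw [diskMeasure, weightedMeasure, integrable_withDensity_iff_integrable_smul' (by fun_prop)
    (Eventually.of_forall fun _ => ENNReal.ofReal_lt_top), IntegrableOn]
  congr! 2 with η
  rw [ENNReal.toReal_ofReal (by positivity), Complex.real_smul, mul_comm]

theorem ae_diskMeasure_mem (e : ℝ) : ∀ᵐ η ∂diskMeasure e, η ∈ ball (0 : ℂ) 1 :=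
  ae_mem_of_weightedMeasure measurableSet_ball _

theorem ae_diskMeasure_ne_zero (e : ℝ) : ∀ᵐ η ∂diskMeasure e, η ≠ 0 :=
  (withDensity_absolutelyContinuous _ _).ae_le (ae_restrict_of_ae (Measure.ae_ne volume 0))

theorem ae_bidiskMeasure_of_ae {q : ℝ} {P Q : ℂ → Prop} (hP : ∀ᵐ η ∂diskMeasure 0, P η)
    (hQ : ∀ᵐ η ∂diskMeasure (q + 2), Q η) : ∀ᵐ w ∂bidiskMeasure q, P w.1 ∧ Q w.2 :=
  (Measure.quasiMeasurePreserving_fst.ae hP).and (Measure.quasiMeasurePreserving_snd.ae hQ)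

theorem ae_bidiskMeasure_mem (q : ℝ) :
    ∀ᵐ w ∂bidiskMeasure q, w.1 ∈ ball (0 : ℂ) 1 ∧ w.2 ∈ ball (0 : ℂ) 1 ∧ w.2 ≠ 0 :=
  ae_bidiskMeasure_of_ae (ae_diskMeasure_mem 0)
    ((ae_diskMeasure_mem _).and (ae_diskMeasure_ne_zero _))

theorem isOpen_hartogsTriangle : IsOpen hartogsTriangle :=
  (isOpen_lt continuous_fst.norm continuous_snd.norm).inter
    (isOpen_lt continuous_snd.norm continuous_const)

theorem snd_ne_zero_of_mem_hartogsTriangle {z : ℂ × ℂ} (hz : z ∈ hartogsTriangle) : z.2 ≠ 0 :=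
  norm_pos_iff.1 ((norm_nonneg _).trans_lt hz.1)

theorem hartogsMap_mem_hartogsTriangle {w : ℂ × ℂ} (h1 : w.1 ∈ ball (0 : ℂ) 1)
    (h2 : w.2 ∈ ball (0 : ℂ) 1) (h0 : w.2 ≠ 0) : hartogsMap w ∈ hartogsTriangle := by
  rw [mem_ball_zero_iff] at h1 h2
  refine ⟨?_, h2⟩
  rw [hartogsMap, norm_mul]
  exact mul_lt_of_lt_one_left (norm_pos_iff.2 h0) h1

theorem hartogsMapInv_hartogsMap {w : ℂ × ℂ} (h0 : w.2 ≠ 0) : hartogsMapInv (hartogsMap w) = w := by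
  simp [hartogsMapInv, hartogsMap, h0]

theorem measurable_hartogsMap : Measurable hartogsMap := by
  unfold hartogsMap
  fun_prop

theorem lintegral_eq_mul_lintegral_comp_mul_right {F : ℂ → ℝ≥0∞} (hF : Measurable F) {c : ℂ}
    (hc : c ≠ 0) : ∫⁻ v, F v = ENNReal.ofReal (‖c‖ ^ 2) * ∫⁻ v, F (v * c) := by
  have hdet : LinearMap.det (LinearMap.mulLeft ℝ c) = ‖c‖ ^ 2 := by
    rw [← Complex.normSq_eq_norm_sq, ← Algebra.norm_complex_apply, Algebra.norm_apply]
    rfl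
  have hpos : 0 < ‖c‖ ^ 2 := by positivity
  have hmap := Measure.map_linearMap_addHaar_eq_smul_addHaar (volume : Measure ℂ)
    (f := LinearMap.mulLeft ℝ c) (by rw [hdet]; exact hpos.ne')
  rw [hdet, abs_of_pos (by positivity)] at hmap
  have hmeas : Measurable (LinearMap.mulLeft ℝ c) := (continuous_const_mul c).measurable
  have hscale : ∫⁻ v, F (v * c) = ENNReal.ofReal (‖c‖ ^ 2)⁻¹ * ∫⁻ v, F v := by
    rw [← smul_eq_mul, ← lintegral_smul_measure, ← hmap, lintegral_map hF hmeas]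
    simp_rw [LinearMap.mulLeft_apply, mul_comm]
  rw [hscale, ← mul_assoc, ← ENNReal.ofReal_mul hpos.le, mul_inv_cancel₀ hpos.ne',
    ENNReal.ofReal_one, one_mul]

theorem setLIntegral_ball_norm_eq_mul {F : ℂ → ℝ≥0∞} (hF : Measurable F) {c : ℂ} (hc : c ≠ 0) :
    ∫⁻ v in ball 0 ‖c‖, F v = ENNReal.ofReal (‖c‖ ^ 2) * ∫⁻ v in ball 0 1, F (v * c) := by
  rw [← lintegral_indicator measurableSet_ball, ← lintegral_indicator measurableSet_ball,
    lintegral_eq_mul_lintegral_comp_mul_right (hF.indicator measurableSet_ball) hc]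
  congr with v
  have hiff : v * c ∈ ball (0 : ℂ) ‖c‖ ↔ v ∈ ball (0 : ℂ) 1 := by
    rw [mem_ball_zero_iff, mem_ball_zero_iff, norm_mul, mul_lt_iff_lt_one_left (norm_pos_iff.2 hc)]
  exact indicator_eq_indicator hiff rfl

theorem setLIntegral_hartogsTriangle {F : ℂ × ℂ → ℝ≥0∞} (hF : Measurable F) :
    ∫⁻ z in hartogsTriangle, F z = ∫⁻ y in ball 0 1, ∫⁻ x in ball 0 ‖y‖, F (x, y) := by
  have hmeas := isOpen_hartogsTriangle.measurableSet
  rw [← lintegral_indicator hmeas, Measure.volume_eq_prod,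
    lintegral_prod_symm' _ (hF.indicator hmeas), ← lintegral_indicator measurableSet_ball]
  congr with y
  by_cases hy : y ∈ ball (0 : ℂ) 1
  · rw [indicator_of_mem hy, ← lintegral_indicator measurableSet_ball]
    congr with x
    have hiff : (x, y) ∈ hartogsTriangle ↔ x ∈ ball 0 ‖y‖ := by
      simp [hartogsTriangle, mem_ball_zero_iff.1 hy]
    exact indicator_eq_indicator hiff rfl
  · have hout : ∀ x, (x, y) ∉ hartogsTriangle := fun x h => hy (mem_ball_zero_iff.2 h.2)
    simp [hy, hout]

theorem measurePreserving_hartogsMap (q : ℝ) :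
    MeasurePreserving hartogsMap (bidiskMeasure q) (hartogsMeasure q) := by
  refine ⟨measurable_hartogsMap, Measure.ext_of_lintegral _ fun g hg => ?_⟩
  have hweight : Measurable (hartogsWeight (-(q + 4))) := by
    unfold hartogsWeight
    fun_prop
  have hg' : Measurable fun w => g (hartogsMap w) := hg.comp measurable_hartogsMap
  rw [lintegral_map hg measurable_hartogsMap, bidiskMeasure, lintegral_prod_symm' _ hg',
    lintegral_diskMeasure _ (Measurable.lintegral_prod_left' hg'),
    lintegral_weightedMeasure hweight hg,
    setLIntegral_hartogsTriangle (by exact hweight.ennreal_ofReal.mul hg)]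
  have hne : ∀ᵐ y : ℂ, y ≠ 0 := Measure.ae_ne volume 0
  refine lintegral_congr_ae (ae_restrict_of_ae (hne.mono fun y hy => ?_))
  have hpow : ‖y‖ ^ (-(q + 2)) = ‖y‖ ^ 2 * ‖y‖ ^ (-(q + 4)) := by
    rw [← Real.rpow_natCast, ← Real.rpow_add (norm_pos_iff.2 hy)]
    norm_num
    ring_nf
  simp only [hartogsWeight]
  rw [lintegral_const_mul' _ _ ENNReal.ofReal_ne_top,
    setLIntegral_ball_norm_eq_mul (by exact hg.comp measurable_prodMk_right) hy,
    lintegral_diskMeasure _ (by exact hg'.comp measurable_prodMk_right), ← mul_assoc,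
    ← ENNReal.ofReal_mul (by positivity), mul_comm (‖y‖ ^ _), hpow]
  simp only [neg_zero, Real.rpow_zero, ENNReal.ofReal_one, one_mul, hartogsMap]

end HartogsMap

section Reproducing

theorem enorm_sq_mul_le_lintegral {f : ℂ → ℂ} {w : ℂ}
    (hf : DifferentiableOn ℂ f (ball w (‖w‖ / 2))) :
    ‖w ^ 2 * f w‖ₑ ≤ 4 * ∫⁻ η in ball w (‖w‖ / 2), ‖f η‖ₑ := by
  have hvol : ‖w‖ₑ ^ 2 ≤ 4 * volume (ball w (‖w‖ / 2)) := by
    have hpi : (1 : ℝ≥0∞) ≤ NNReal.pi :=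
      ENNReal.one_le_coe_iff.2
        (NNReal.coe_le_coe.1 (by simpa using Real.two_le_pi.trans' one_le_two))
    have hhalf : ‖w‖ₑ = 2 * ENNReal.ofReal (‖w‖ / 2) := by
      rw [← ofReal_norm, ← ENNReal.ofReal_ofNat, ← ENNReal.ofReal_mul (by norm_num)]
      ring_nf
    rw [Complex.volume_ball, hhalf, mul_pow, ← mul_assoc]
    norm_num
    exact le_mul_of_one_le_right' hpi
  calc ‖w ^ 2 * f w‖ₑ = ‖w‖ₑ ^ 2 * ‖f w‖ₑ := by rw [enorm_mul, enorm_pow]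
    _ ≤ 4 * volume (ball w (‖w‖ / 2)) * ‖f w‖ₑ := by gcongr
    _ = 4 * (‖f w‖ₑ * volume (ball w (‖w‖ / 2))) := by ring
    _ ≤ _ := by gcongr; exact enorm_mul_volume_ball_le hf

theorem ball_half_norm_subset {w : ℂ} {R : ℝ} (hw : w ∈ ball (0 : ℂ) (R / 2)) :
    ball w (‖w‖ / 2) ⊆ ball 0 R \ {0} := by
  rw [mem_ball_zero_iff] at hw
  refine fun η hη => ⟨ball_subset_ball' ?_ hη, fun h0 => ?_⟩
  · rw [dist_zero_right]
    linarith [norm_nonneg w]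
  · rw [mem_singleton_iff.1 h0, mem_ball, dist_zero_left] at hη
    linarith [norm_nonneg w]

theorem tendsto_volume_ball_half_norm :
    Tendsto (fun w : ℂ => volume (ball w (‖w‖ / 2))) (𝓝 0) (𝓝 0) := by
  have hcont : Continuous fun w : ℂ => ENNReal.ofReal (‖w‖ / 2) ^ 2 * (NNReal.pi : ℝ≥0∞) :=
    (ENNReal.continuous_mul_const ENNReal.coe_ne_top).comp
      ((ENNReal.continuous_pow 2).comp (ENNReal.continuous_ofReal.comp (by fun_prop)))
  simpa [Complex.volume_ball] using hcont.tendsto 0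

theorem tendsto_sq_mul_nhdsNE_zero {f : ℂ → ℂ} {R : ℝ} (hR : 0 < R)
    (hf : DifferentiableOn ℂ f (ball 0 R \ {0})) (hint : IntegrableOn f (ball 0 R)) :
    Tendsto (fun w => w ^ 2 * f w) (𝓝[≠] 0) (𝓝 0) := by
  have hvol : Tendsto (fun w : ℂ => volume.restrict (ball 0 R) (ball w (‖w‖ / 2)))
      (𝓝[≠] 0) (𝓝 0) :=
    tendsto_of_tendsto_of_tendsto_of_le_of_le tendsto_const_nhds
      (tendsto_volume_ball_half_norm.mono_left nhdsWithin_le_nhds) (fun _ => zero_le)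
      fun _ => Measure.restrict_apply_le _ _
  have hlim := ENNReal.Tendsto.const_mul (a := 4)
    (tendsto_setLIntegral_zero hint.hasFiniteIntegral.ne hvol) (Or.inr (by norm_num))
  rw [mul_zero] at hlim
  rw [tendsto_zero_iff_enorm_tendsto_zero]
  refine tendsto_of_tendsto_of_tendsto_of_le_of_le' tendsto_const_nhds hlim
    (Eventually.of_forall fun _ => zero_le) ?_
  have hmem : ball (0 : ℂ) (R / 2) ∈ 𝓝[≠] 0 := nhdsWithin_le_nhds (ball_mem_nhds _ (by linarith))
  filter_upwards [hmem] with w hw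
  have hsub := ball_half_norm_subset hw
  rw [Measure.restrict_restrict measurableSet_ball,
    inter_eq_self_of_subset_left (hsub.trans sdiff_subset)]
  exact enorm_sq_mul_le_lintegral (hf.mono hsub)

/- Integrability leaves `f` at most a simple pole at the origin. -/
theorem exists_differentiableOn_eq_mul {f : ℂ → ℂ} {R : ℝ} (hR : 0 < R)
    (hf : DifferentiableOn ℂ f (ball 0 R \ {0})) (hint : IntegrableOn f (ball 0 R)) :
    ∃ H : ℂ → ℂ, DifferentiableOn ℂ H (ball 0 R) ∧ ∀ η, η ≠ 0 → H η = η * f η := by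
  refine ⟨_, Complex.differentiableOn_update_limUnder_of_isLittleO
    (ball_mem_nhds (0 : ℂ) hR) (differentiableOn_id.mul hf) ?_,
    fun η hη => Function.update_of_ne hη _ _⟩
  rw [Asymptotics.isLittleO_iff_tendsto']
  · refine (tendsto_sq_mul_nhdsNE_zero hR hf hint).congr fun w => ?_
    simp only [Pi.mul_apply, sub_zero, div_inv_eq_mul]
    ring
  · filter_upwards [self_mem_nhdsWithin] with w hw h0
    exact absurd (inv_eq_zero.1 h0) (sub_ne_zero.2 hw)

theorem norm_diskKernel_mul_conj_le (q : ℝ) {w η : ℂ} (hw : w ∈ ball (0 : ℂ) 1)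
    (hη : η ∈ ball (0 : ℂ) 1) :
    ‖diskKernel q (w * conj η)‖ ≤ (1 + |q|) * ((1 - ‖w‖) ^ 2)⁻¹ := by
  rw [mem_ball_zero_iff] at hw hη
  have : 0 < 1 - ‖w‖ := by linarith
  have hle : 1 - ‖w‖ ≤ ‖1 - w * conj η‖ := by
    have htri := norm_sub_norm_le (1 : ℂ) (w * conj η)
    rw [norm_one, norm_mul, RCLike.norm_conj] at htri
    linarith [mul_le_of_le_one_right (norm_nonneg w) hη.le]
  refine (norm_diskKernel_le q (norm_mul_conj_lt_one hw hη)).trans ?_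
  gcongr

theorem integrableOn_diskKernel_mul (q : ℝ) {w : ℂ} (hw : w ∈ ball (0 : ℂ) 1) {g : ℂ → ℂ}
    (hg : IntegrableOn g (ball 0 1)) :
    IntegrableOn (fun η => diskKernel q (w * conj η) * g η) (ball 0 1) :=
  Integrable.bdd_mul hg ((measurable_diskKernel q).comp (by fun_prop)).aestronglyMeasurable
    ((ae_restrict_iff' measurableSet_ball).2
      (Eventually.of_forall fun _ hη => norm_diskKernel_mul_conj_le q hw hη))

theorem integral_diskKernel_zero_mul {G : ℂ → ℂ} (hG : DifferentiableOn ℂ G (ball 0 1))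
    (hint : Integrable G (diskMeasure 0)) {w : ℂ} (hw : w ∈ ball (0 : ℂ) 1) :
    ∫ η, diskKernel 0 (w * conj η) * G η ∂diskMeasure 0 = G w := by
  rw [integrable_diskMeasure_iff] at hint
  rw [integral_diskMeasure]
  refine integral_diskKernel_mul (by norm_num) hG hw ?_
  simp_rw [mul_assoc]
  exact integrableOn_diskKernel_mul 0 hw hint

theorem conj_mul_norm_rpow (q : ℝ) {η : ℂ} (hη : η ≠ 0) :
    conj η * (‖η‖ ^ (-(q + 2)) : ℝ) = η⁻¹ * (‖η‖ ^ (-q) : ℝ) := by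
  have hpos : 0 < ‖η‖ := norm_pos_iff.2 hη
  rw [neg_add, Real.rpow_add hpos, Real.rpow_neg hpos.le 2, Real.rpow_two, Complex.ofReal_mul,
    Complex.ofReal_inv, Complex.ofReal_pow, ← Complex.mul_conj']
  have hconj : conj η ≠ 0 := (map_ne_zero _).2 hη
  field_simp

theorem integrableOn_div_sq {q : ℝ} (hq : 1 ≤ q) {g : ℂ → ℂ}
    (hint : IntegrableOn (fun η => g η / η * (‖η‖ ^ (-q) : ℝ)) (ball 0 1)) :
    IntegrableOn (fun η => g η / η ^ 2) (ball 0 1) := by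
  have hbound : ∀ η ∈ ball (0 : ℂ) 1, ‖η⁻¹ * (‖η‖ ^ q : ℝ)‖ ≤ 1 := by
    intro η hη
    rw [norm_mul, norm_inv, Complex.norm_real, Real.norm_of_nonneg (by positivity)]
    rcases eq_or_ne η 0 with rfl | hη0
    · simp
    rw [inv_mul_le_one₀ (norm_pos_iff.2 hη0)]
    exact Real.rpow_le_self_of_le_one (norm_nonneg η) (mem_ball_zero_iff.1 hη).le hq
  have hmeas : Measurable fun η : ℂ => η⁻¹ * ((‖η‖ ^ q : ℝ) : ℂ) := by fun_prop
  have hprod := Integrable.bdd_mul hint hmeas.aestronglyMeasurable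
    ((ae_restrict_iff' measurableSet_ball).2 (Eventually.of_forall hbound))
  refine hprod.congr (Eventually.of_forall fun η => ?_)
  rcases eq_or_ne η 0 with rfl | hη0
  · simp
  have hcancel : ((‖η‖ ^ q : ℝ) : ℂ) * (‖η‖ ^ (-q) : ℝ) = 1 := by
    rw [← Complex.ofReal_mul, ← Real.rpow_add (norm_pos_iff.2 hη0), add_neg_cancel, Real.rpow_zero,
      Complex.ofReal_one]
  simp only
  rw [div_eq_mul_inv (g η), div_eq_mul_inv (g η), ← inv_pow]
  linear_combination (η⁻¹ ^ 2 * g η) * hcancel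

theorem exists_differentiableOn_eq_div {q : ℝ} (hq : 1 ≤ q) {G : ℂ → ℂ}
    (hG : DifferentiableOn ℂ G (ball 0 1 \ {0}))
    (hint : IntegrableOn (fun η => G η / η * (‖η‖ ^ (-q) : ℝ)) (ball 0 1)) :
    ∃ H : ℂ → ℂ, DifferentiableOn ℂ H (ball 0 1) ∧ ∀ η, η ≠ 0 → H η = G η / η := by
  have hdiff : DifferentiableOn ℂ (fun η => G η / η ^ 2) (ball 0 1 \ {0}) :=
    hG.div (by fun_prop) fun η hη => pow_ne_zero 2 hη.2
  obtain ⟨H, hH, hHG⟩ := exists_differentiableOn_eq_mul one_pos hdiff (integrableOn_div_sq hq hint)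
  refine ⟨H, hH, fun η hη => ?_⟩
  rw [hHG η hη]
  field_simp

theorem integral_mul_diskKernel_mul {q : ℝ} (hq1 : 1 ≤ q) (hq2 : q < 2) {G : ℂ → ℂ}
    (hG : DifferentiableOn ℂ G (ball 0 1 \ {0}))
    (hint : Integrable (fun η => conj η * G η) (diskMeasure (q + 2))) {w : ℂ}
    (hw : w ∈ ball (0 : ℂ) 1) (hw0 : w ≠ 0) :
    ∫ η, w * conj η * diskKernel q (w * conj η) * G η ∂diskMeasure (q + 2) = G w := by
  have hne : ∀ᵐ η ∂(volume.restrict (ball (0 : ℂ) 1)), η ≠ 0 :=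
    ae_restrict_of_ae (Measure.ae_ne volume 0)
  have hint_div : IntegrableOn (fun η => G η / η * (‖η‖ ^ (-q) : ℝ)) (ball 0 1) := by
    refine ((integrable_diskMeasure_iff _ _).1 hint).congr (hne.mono fun η hη => ?_)
    simp only
    linear_combination G η * conj_mul_norm_rpow q hη
  obtain ⟨H, hH, hHG⟩ := exists_differentiableOn_eq_div hq1 hG hint_div
  have hint_H : IntegrableOn (fun η => H η * (‖η‖ ^ (-q) : ℝ)) (ball 0 1) :=
    hint_div.congr (hne.mono fun η hη => by simp only [hHG η hη])
  rw [integral_diskMeasure]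
  calc _ = ∫ η in ball (0 : ℂ) 1, w * (diskKernel q (w * conj η) * H η * (‖η‖ ^ (-q) : ℝ)) := by
        refine integral_congr_ae (hne.mono fun η hη => ?_)
        simp only [hHG η hη]
        linear_combination (w * diskKernel q (w * conj η) * G η) * conj_mul_norm_rpow q hη
    _ = w * H w := by
        rw [integral_const_mul, integral_diskKernel_mul hq2 hH hw]
        simp_rw [mul_assoc]
        exact integrableOn_diskKernel_mul q hw hint_H
    _ = G w := by rw [hHG w hw0, mul_div_cancel₀ _ hw0]

end Reproducing

section Projection

theorem lintegral_ball_ofReal_norm_rpow_lt_top_iff {κ : ℝ} :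
    ∫⁻ η in ball (0 : ℂ) 1, ENNReal.ofReal (‖η‖ ^ κ) < ∞ ↔ -2 < κ := by
  have hpolar : ∫⁻ η in ball (0 : ℂ) 1, ENNReal.ofReal (‖η‖ ^ κ) =
      ENNReal.ofReal (2 * Real.pi) * ∫⁻ r in Ioo (0 : ℝ) 1, ENNReal.ofReal (r ^ (κ + 1)) := by
    rw [lintegral_ball_eq_polar (by fun_prop), ← lintegral_const_mul _ (by fun_prop)]
    refine setLIntegral_congr_fun measurableSet_Ioo fun r hr => ?_
    simp only [norm_circleMap_zero, abs_of_pos hr.1, setLIntegral_const, Real.volume_Ioo]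
    rw [← ENNReal.ofReal_mul (Real.rpow_nonneg hr.1.le κ), ← ENNReal.ofReal_mul hr.1.le,
      ← ENNReal.ofReal_mul (by positivity), Real.rpow_add_one hr.1.ne']
    ring_nf
  have hnonneg : 0 ≤ᵐ[volume.restrict (Ioo (0 : ℝ) 1)] fun r => r ^ (κ + 1) :=
    ae_restrict_of_forall_mem measurableSet_Ioo fun r hr => Real.rpow_nonneg hr.1.le _
  have hmeas : Measurable fun r : ℝ => r ^ (κ + 1) := by fun_prop
  calc _ ↔ ∫⁻ r in Ioo (0 : ℝ) 1, ENNReal.ofReal (r ^ (κ + 1)) < ∞ := by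
        rw [hpolar]
        exact ENNReal.nnreal_smul_lt_top_iff (Real.toNNReal_pos.2 (by positivity)).ne'
    _ ↔ IntegrableOn (fun r : ℝ => r ^ (κ + 1)) (Ioo 0 1) := by
        rw [← hasFiniteIntegral_iff_ofReal hnonneg, IntegrableOn, Integrable,
          and_iff_right hmeas.aestronglyMeasurable]
    _ ↔ -2 < κ := by
        rw [intervalIntegral.integrableOn_Ioo_rpow_iff one_pos]
        constructor <;> intro <;> linarith

theorem memLp_snd_mul_norm_rpow_iff {q m p : ℝ} (hp : 0 < p) :
    MemLp (fun w : ℂ × ℂ => w.2 * (‖w.2‖ ^ m : ℝ)) (ENNReal.ofReal p) (bidiskMeasure q) ↔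
      q < (1 + m) * p := by
  have hne : ∀ᵐ η : ℂ, η ≠ 0 := Measure.ae_ne volume 0
  have hmeas : Measurable fun w : ℂ × ℂ => w.2 * ((‖w.2‖ ^ m : ℝ) : ℂ) := by fun_prop
  have hsplit : ∫⁻ w, ‖w.2 * ((‖w.2‖ ^ m : ℝ) : ℂ)‖ₑ ^ p ∂bidiskMeasure q =
      (∫⁻ _, 1 ∂diskMeasure 0) * ∫⁻ η, ‖η * ((‖η‖ ^ m : ℝ) : ℂ)‖ₑ ^ p ∂diskMeasure (q + 2) := by
    rw [bidiskMeasure, ← lintegral_prod_mul (by fun_prop) (by fun_prop)]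
    simp only [one_mul]
  have hfst : ∫⁻ _, 1 ∂diskMeasure 0 = NNReal.pi := by
    rw [lintegral_diskMeasure _ measurable_const]
    simp
  have hsnd : ∫⁻ η, ‖η * ((‖η‖ ^ m : ℝ) : ℂ)‖ₑ ^ p ∂diskMeasure (q + 2) =
      ∫⁻ η in ball (0 : ℂ) 1, ENNReal.ofReal (‖η‖ ^ ((1 + m) * p - (q + 2))) := by
    rw [lintegral_diskMeasure _ (by fun_prop)]
    refine lintegral_congr_ae (ae_restrict_of_ae (hne.mono fun η hη => ?_))
    have hpos : 0 < ‖η‖ := norm_pos_iff.2 hη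
    have hnorm : ‖η * ((‖η‖ ^ m : ℝ) : ℂ)‖ = ‖η‖ ^ (1 + m) := by
      rw [norm_mul, Complex.norm_real, Real.norm_of_nonneg (by positivity), Real.rpow_add hpos,
        Real.rpow_one]
    simp only
    rw [← ofReal_norm, hnorm, ENNReal.ofReal_rpow_of_nonneg (by positivity) hp.le,
      ← Real.rpow_mul hpos.le, ← ENNReal.ofReal_mul (by positivity), ← Real.rpow_add hpos]
    ring_nf
  rw [MemLp, and_iff_right hmeas.aestronglyMeasurable,
    eLpNorm_lt_top_iff_lintegral_rpow_enorm_lt_top (by simpa) ENNReal.ofReal_ne_top,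
    ENNReal.toReal_ofReal hp.le, hsplit, hfst, hsnd]
  refine (ENNReal.nnreal_smul_lt_top_iff NNReal.pi_ne_zero).trans
    (lintegral_ball_ofReal_norm_rpow_lt_top_iff.trans ?_)
  constructor <;> intro <;> linarith

theorem memLp_conj_snd {q : ℝ} (hq : q < 2) :
    MemLp (fun η : ℂ × ℂ => conj η.2) 2 (bidiskMeasure q) := by
  have hsnd : MemLp (fun w : ℂ × ℂ => w.2) 2 (bidiskMeasure q) := by
    simpa using (memLp_snd_mul_norm_rpow_iff (q := q) (m := 0) two_pos).2 (by linarith)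
  exact hsnd.star

/-- The Bergman kernel of the Hartogs triangle in the coordinates of the bidisc. The square
integrable holomorphic functions are those divisible by `w.2`, which accounts for the factor
`w.2 * conj η.2`. -/
noncomputable def bidiskKernel (q : ℝ) (w η : ℂ × ℂ) : ℂ :=
  diskKernel 0 (w.1 * conj η.1) * (w.2 * conj η.2 * diskKernel q (w.2 * conj η.2))

theorem conj_bidiskKernel (q : ℝ) (w η : ℂ × ℂ) :
    conj (bidiskKernel q w η) = bidiskKernel q η w := by
  simp only [bidiskKernel, map_mul, conj_diskKernel, Complex.conj_conj, mul_comm (conj _)]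

theorem measurable_bidiskKernel (q : ℝ) : Measurable (Function.uncurry (bidiskKernel q)) := by
  have hfst : Measurable fun x : (ℂ × ℂ) × (ℂ × ℂ) => x.1.1 * conj x.2.1 := by fun_prop
  have hsnd : Measurable fun x : (ℂ × ℂ) × (ℂ × ℂ) => x.1.2 * conj x.2.2 := by fun_prop
  exact ((measurable_diskKernel 0).comp hfst).mul (hsnd.mul ((measurable_diskKernel q).comp hsnd))

theorem exists_norm_bidiskKernel_le (q : ℝ) {w : ℂ × ℂ} (h1 : w.1 ∈ ball (0 : ℂ) 1)
    (h2 : w.2 ∈ ball (0 : ℂ) 1) :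
    ∃ C : ℝ, ∀ η : ℂ × ℂ, η.1 ∈ ball (0 : ℂ) 1 → η.2 ∈ ball (0 : ℂ) 1 →
      ‖bidiskKernel q w η‖ ≤ C * ‖conj η.2‖ := by
  refine ⟨(1 + |0|) * ((1 - ‖w.1‖) ^ 2)⁻¹ * (‖w.2‖ * ((1 + |q|) * ((1 - ‖w.2‖) ^ 2)⁻¹)),
    fun η hη1 hη2 => ?_⟩
  have hfst := norm_diskKernel_mul_conj_le 0 h1 hη1
  have hsnd := norm_diskKernel_mul_conj_le q h2 hη2
  calc ‖bidiskKernel q w η‖ = ‖diskKernel 0 (w.1 * conj η.1)‖ *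
        (‖w.2‖ * ‖diskKernel q (w.2 * conj η.2)‖) * ‖conj η.2‖ := by
        rw [bidiskKernel, norm_mul, norm_mul, norm_mul]
        ring
    _ ≤ _ := by gcongr

theorem memLp_bidiskKernel {q : ℝ} (hq : q < 2) {w : ℂ × ℂ} (h1 : w.1 ∈ ball (0 : ℂ) 1)
    (h2 : w.2 ∈ ball (0 : ℂ) 1) : MemLp (bidiskKernel q w) 2 (bidiskMeasure q) := by
  obtain ⟨C, hC⟩ := exists_norm_bidiskKernel_le q h1 h2
  exact (memLp_conj_snd hq).of_le_mul
    (measurable_bidiskKernel q).of_uncurry_left.aestronglyMeasurable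
    ((ae_bidiskMeasure_mem q).mono fun η hη => hC η hη.1 hη.2.1)

theorem ae_integral_bidiskKernel_mul {q : ℝ} (hq1 : 1 ≤ q) (hq2 : q < 2) {G : ℂ × ℂ → ℂ}
    (hG : DifferentiableOn ℂ G (ball 0 1 ×ˢ (ball 0 1 \ {0})))
    (hG2 : MemLp G 2 (bidiskMeasure q)) :
    ∀ᵐ w ∂bidiskMeasure q, ∫ η, bidiskKernel q w η * G η ∂bidiskMeasure q = G w := by
  have hint : Integrable (fun η : ℂ × ℂ => conj η.2 * G η) (bidiskMeasure q) :=
    (memLp_conj_snd hq2).integrable_mul hG2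
  rw [bidiskMeasure] at hint
  filter_upwards [ae_bidiskMeasure_of_ae (ae_diskMeasure_mem 0)
    ((ae_diskMeasure_mem _).and ((ae_diskMeasure_ne_zero _).and hint.prod_left_ae))]
    with w ⟨hw1, hw2, hw0, hw_slice⟩
  have hGw : Integrable (fun x => G (x, w.2)) (diskMeasure 0) := by
    refine (hw_slice.const_mul (conj w.2)⁻¹).congr (Eventually.of_forall fun x => ?_)
    exact inv_mul_cancel_left₀ ((map_ne_zero _).2 hw0) _
  have hint_kernel : Integrable (fun η => bidiskKernel q w η * G η) (bidiskMeasure q) :=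
    (memLp_bidiskKernel hq2 hw1 hw2).integrable_mul hG2
  have hGw_diff : DifferentiableOn ℂ (fun x => G (x, w.2)) (ball 0 1) :=
    hG.comp (by fun_prop) fun x hx => ⟨hx, hw2, hw0⟩
  rw [bidiskMeasure] at hint_kernel ⊢
  rw [integral_prod _ hint_kernel]
  calc _ = ∫ x, diskKernel 0 (w.1 * conj x) * G (x, w.2) ∂diskMeasure 0 := by
        refine integral_congr_ae ?_
        filter_upwards [ae_diskMeasure_mem 0, hint.prod_right_ae] with x hx hx_slice
        have hGx : DifferentiableOn ℂ (fun y => G (x, y)) (ball 0 1 \ {0}) :=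
          hG.comp (by fun_prop) fun y hy => ⟨hx, hy⟩
        rw [← integral_mul_diskKernel_mul hq1 hq2 hGx hx_slice hw2 hw0, ← integral_const_mul]
        simp only [bidiskKernel, mul_assoc]
    _ = G w := integral_diskKernel_zero_mul hGw_diff hGw hw1

theorem memLp_comp_hartogsMap_iff {q : ℝ} {p : ℝ≥0∞} {f : ℂ × ℂ → ℂ}
    (hf : AEStronglyMeasurable f (hartogsMeasure q)) :
    MemLp (fun w => f (hartogsMap w)) p (bidiskMeasure q) ↔ MemLp f p (hartogsMeasure q) := by
  rw [← (measurePreserving_hartogsMap q).map_eq] at hf ⊢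
  exact (memLp_map_measure_iff hf measurable_hartogsMap.aemeasurable).symm

theorem integral_comp_hartogsMap {q : ℝ} {f : ℂ × ℂ → ℂ}
    (hf : AEStronglyMeasurable f (hartogsMeasure q)) :
    ∫ w, f (hartogsMap w) ∂bidiskMeasure q = ∫ z, f z ∂hartogsMeasure q := by
  rw [← (measurePreserving_hartogsMap q).map_eq] at hf ⊢
  exact (integral_map measurable_hartogsMap.aemeasurable hf).symm

theorem measurable_hartogsMapInv : Measurable hartogsMapInv := by
  unfold hartogsMapInv
  fun_prop

theorem memLp_bidiskKernel_hartogsMapInv {q : ℝ} (hq : q < 2) {w : ℂ × ℂ}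
    (h1 : w.1 ∈ ball (0 : ℂ) 1) (h2 : w.2 ∈ ball (0 : ℂ) 1) :
    MemLp (fun z => bidiskKernel q (hartogsMapInv z) w) 2 (hartogsMeasure q) := by
  have hmeas : Measurable fun z => bidiskKernel q (hartogsMapInv z) w :=
    (measurable_bidiskKernel q).of_uncurry_right.comp measurable_hartogsMapInv
  have hconj : MemLp (fun η => conj (bidiskKernel q w η)) 2 (bidiskMeasure q) :=
    (memLp_bidiskKernel hq h1 h2).star
  rw [← memLp_comp_hartogsMap_iff hmeas.aestronglyMeasurable]
  refine hconj.ae_eq ((ae_bidiskMeasure_mem q).mono fun η hη => ?_)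
  simp only [hartogsMapInv_hartogsMap hη.2.2, conj_bidiskKernel]

theorem differentiableOn_bidiskKernel_hartogsMapInv (q : ℝ) {w : ℂ × ℂ}
    (h1 : w.1 ∈ ball (0 : ℂ) 1) (h2 : w.2 ∈ ball (0 : ℂ) 1) :
    DifferentiableOn ℂ (fun z => bidiskKernel q (hartogsMapInv z) w) hartogsTriangle := by
  have hfst : DifferentiableOn ℂ (fun z : ℂ × ℂ => z.1 / z.2 * conj w.1) hartogsTriangle :=
    (differentiableOn_fst.mul (differentiableOn_snd.inv fun z hz =>
      snd_ne_zero_of_mem_hartogsTriangle hz)).mul_const _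
  have hsnd : DifferentiableOn ℂ (fun z : ℂ × ℂ => z.2 * conj w.2) hartogsTriangle :=
    differentiableOn_snd.mul_const _
  have hfst_mem : MapsTo (fun z : ℂ × ℂ => z.1 / z.2 * conj w.1) hartogsTriangle (ball 0 1) := by
    intro z hz
    rw [mem_ball_zero_iff] at h1 ⊢
    refine norm_mul_conj_lt_one ?_ h1
    rw [norm_div, div_lt_one ((norm_nonneg _).trans_lt hz.1)]
    exact hz.1
  have hsnd_mem : MapsTo (fun z : ℂ × ℂ => z.2 * conj w.2) hartogsTriangle (ball 0 1) :=
    fun z hz => mem_ball_zero_iff.2 (norm_mul_conj_lt_one hz.2 (mem_ball_zero_iff.1 h2))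
  exact ((differentiableOn_diskKernel 0).comp hfst hfst_mem).mul
    (hsnd.mul ((differentiableOn_diskKernel q).comp hsnd hsnd_mem))

theorem inner_bidiskKernel_hartogsMapInv {q : ℝ} {w : ℂ × ℂ}
    (hk : MemLp (fun z => bidiskKernel q (hartogsMapInv z) w) 2 (hartogsMeasure q))
    (u : Lp ℂ 2 (hartogsMeasure q)) :
    inner ℂ (hk.toLp _) u =
      ∫ η, bidiskKernel q w η * u (hartogsMap η) ∂bidiskMeasure q := by
  have hmeas : AEStronglyMeasurable (fun z => bidiskKernel q w (hartogsMapInv z) * u z)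
      (hartogsMeasure q) := by
    refine AEStronglyMeasurable.mul ?_ (Lp.aestronglyMeasurable u)
    exact ((measurable_bidiskKernel q).of_uncurry_left.comp
      measurable_hartogsMapInv).aestronglyMeasurable
  calc inner ℂ (hk.toLp _) u
      = ∫ z, bidiskKernel q w (hartogsMapInv z) * u z ∂hartogsMeasure q := by
        rw [L2.inner_def]
        refine integral_congr_ae (hk.coeFn_toLp.mono fun z hz => ?_)
        simp only [hz, RCLike.inner_apply, conj_bidiskKernel, mul_comm]
    _ = ∫ η, bidiskKernel q w (hartogsMapInv (hartogsMap η)) * u (hartogsMap η)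
          ∂bidiskMeasure q := (integral_comp_hartogsMap hmeas).symm
    _ = _ := by
        refine integral_congr_ae ((ae_bidiskMeasure_mem q).mono fun η hη => ?_)
        simp only [hartogsMapInv_hartogsMap hη.2.2]

theorem inner_bergmanProjection_of_mem {E : Type*} [NormedAddCommGroup E] [NormedSpace ℂ E]
    [MeasureSpace E] {Ω : Set E} {μ : E → ℝ} [(bergmanSpace Ω μ).HasOrthogonalProjection]
    {k : Lp ℂ 2 (weightedMeasure Ω μ)} (hk : k ∈ bergmanSpace Ω μ)
    (f : Lp ℂ 2 (weightedMeasure Ω μ)) : inner ℂ k (bergmanProjection Ω μ f) = inner ℂ k f := by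
  rw [bergmanProjection, ← Submodule.inner_starProjection_left_eq_right,
    Submodule.starProjection_eq_self_iff.2 hk]

theorem ae_bergmanProjection_eq_integral {q : ℝ} (hq1 : 1 ≤ q) (hq2 : q < 2)
    (f : Lp ℂ 2 (hartogsMeasure q)) :
    ∀ᵐ w ∂bidiskMeasure q,
      bergmanProjection hartogsTriangle (hartogsWeight (-(q + 4))) f (hartogsMap w) =
        ∫ η, bidiskKernel q w η * f (hartogsMap η) ∂bidiskMeasure q := by
  have hP := measurePreserving_hartogsMap q
  set u := bergmanProjection hartogsTriangle (hartogsWeight (-(q + 4))) f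
  obtain ⟨g, hg, hug⟩ : u ∈ bergmanSpace hartogsTriangle (hartogsWeight (-(q + 4))) :=
    Submodule.starProjection_apply_mem _ f
  have hug' : ∀ᵐ w ∂bidiskMeasure q, u (hartogsMap w) = g (hartogsMap w) :=
    hP.quasiMeasurePreserving.ae hug
  have hg2 : MemLp (fun w => g (hartogsMap w)) 2 (bidiskMeasure q) :=
    ((Lp.memLp u).comp_measurePreserving hP).ae_eq hug'
  have hg_diff : DifferentiableOn ℂ (fun w => g (hartogsMap w))
      (ball 0 1 ×ˢ (ball 0 1 \ {0})) := by
    refine hg.comp ?_ fun w hw => hartogsMap_mem_hartogsTriangle hw.1 hw.2.1 hw.2.2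
    unfold hartogsMap
    fun_prop
  filter_upwards [ae_integral_bidiskKernel_mul hq1 hq2 hg_diff hg2, hug', ae_bidiskMeasure_mem q]
    with w hrep hw_eq ⟨hw1, hw2, _⟩
  have hk := memLp_bidiskKernel_hartogsMapInv hq2 hw1 hw2
  have hk_mem : hk.toLp _ ∈ bergmanSpace hartogsTriangle (hartogsWeight (-(q + 4))) :=
    ⟨_, differentiableOn_bidiskKernel_hartogsMapInv q hw1 hw2, hk.coeFn_toLp⟩
  calc u (hartogsMap w) = ∫ η, bidiskKernel q w η * g (hartogsMap η) ∂bidiskMeasure q := by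
        rw [hw_eq, hrep]
    _ = ∫ η, bidiskKernel q w η * u (hartogsMap η) ∂bidiskMeasure q :=
        integral_congr_ae (hug'.mono fun η hη => by simp only [hη])
    _ = inner ℂ (hk.toLp _) u := (inner_bidiskKernel_hartogsMapInv hk u).symm
    _ = inner ℂ (hk.toLp _) f := inner_bergmanProjection_of_mem hk_mem f
    _ = _ := inner_bidiskKernel_hartogsMapInv hk f

end Projection

section Duality

variable {α : Type*} [MeasurableSpace α] {ν : Measure α} {p p' : ℝ}

theorem eLpNorm_ofReal_eq_lintegral_rpow (hp : 0 < p) (f : α → ℂ) :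
    eLpNorm f (ENNReal.ofReal p) ν = (∫⁻ z, ‖f z‖ₑ ^ p ∂ν) ^ (1 / p) := by
  rw [eLpNorm_eq_lintegral_rpow_enorm_toReal (ENNReal.ofReal_pos.2 hp).ne' ENNReal.ofReal_ne_top,
    ENNReal.toReal_ofReal hp.le]

theorem rpow_one_div_le_of_le_mul_rpow (hpp : p.HolderConjugate p') {I M : ℝ≥0∞} (hI : I ≠ ∞)
    (h : I ≤ M * I ^ (1 / p)) : I ^ (1 / p') ≤ M := by
  rcases eq_or_ne I 0 with rfl | hI0
  · rw [ENNReal.zero_rpow_of_pos (one_div_pos.2 hpp.symm.pos)]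
    exact zero_le
  have hsplit : I = I ^ (1 / p') * I ^ (1 / p) := by
    rw [← ENNReal.rpow_add _ _ hI0 hI, one_div, one_div, hpp.symm.inv_add_inv_eq_one,
      ENNReal.rpow_one]
  have hpos : I ^ (1 / p) ≠ 0 := (ENNReal.rpow_pos hI0.bot_lt hI).ne'
  have htop : I ^ (1 / p) ≠ ∞ := ENNReal.rpow_ne_top_of_nonneg (one_div_nonneg.2 hpp.nonneg) hI
  refine (ENNReal.mul_le_mul_iff_left hpos htop).1 ?_
  rwa [← hsplit]

/-- The function `|u| ^ (p' - 2) u`, extremal for Hölder's inequality against `u`, cut off to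
`S`. -/
noncomputable def holderExtremal (p' : ℝ) (S : Set α) (u : α → ℂ) : α → ℂ :=
  S.indicator fun z => u z * (‖u z‖ ^ (p' - 2) : ℝ)

theorem norm_mul_norm_rpow_sub_two (hp' : 1 < p') (ζ : ℂ) :
    ‖ζ * (‖ζ‖ ^ (p' - 2) : ℝ)‖ = ‖ζ‖ ^ (p' - 1) := by
  rcases eq_or_ne ζ 0 with rfl | hζ
  · rw [zero_mul, norm_zero, Real.zero_rpow (by linarith)]
  · rw [norm_mul, Complex.norm_real, Real.norm_of_nonneg (by positivity),
      ← Real.rpow_one_add' (by positivity) (by linarith)]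
    ring_nf

theorem conj_mul_norm_rpow_sub_two_mul_self (hp' : 1 < p') (ζ : ℂ) :
    conj (ζ * (‖ζ‖ ^ (p' - 2) : ℝ)) * ζ = (‖ζ‖ ^ p' : ℝ) := by
  have hpow : ‖ζ‖ ^ p' = ‖ζ‖ ^ (2 : ℝ) * ‖ζ‖ ^ (p' - 2) := by
    rw [← Real.rpow_add' (norm_nonneg ζ) (by linarith)]
    ring_nf
  rw [map_mul, Complex.conj_ofReal, mul_right_comm, Complex.conj_mul', hpow, Real.rpow_two]
  push_cast
  rfl

theorem memLp_holderExtremal (hp' : 1 < p') {S : Set α} (hS : MeasurableSet S) (hSν : ν S ≠ ∞)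
    {u : α → ℂ} (hu : Measurable u) {b : ℝ} (hb : ∀ z ∈ S, ‖u z‖ ≤ b) (r : ℝ≥0∞) :
    MemLp (holderExtremal p' S u) r ν := by
  have : IsFiniteMeasure (ν.restrict S) := isFiniteMeasure_restrict.2 hSν
  rw [holderExtremal, memLp_indicator_iff_restrict hS]
  refine MemLp.of_bound (by fun_prop) (b ^ (p' - 1)) ?_
  refine ae_restrict_of_forall_mem hS fun z hz => ?_
  rw [norm_mul_norm_rpow_sub_two hp']
  exact Real.rpow_le_rpow (norm_nonneg _) (hb z hz) (by linarith)

theorem lintegral_enorm_holderExtremal_rpow (hpp : p.HolderConjugate p') {S : Set α}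
    (hS : MeasurableSet S) (u : α → ℂ) :
    ∫⁻ z, ‖holderExtremal p' S u z‖ₑ ^ p ∂ν = ∫⁻ z in S, ‖u z‖ₑ ^ p' ∂ν := by
  rw [← lintegral_indicator hS]
  refine lintegral_congr fun z => ?_
  by_cases hz : z ∈ S
  · rw [holderExtremal, indicator_of_mem hz, indicator_of_mem hz, ← ofReal_norm,
      norm_mul_norm_rpow_sub_two hpp.symm.lt, ENNReal.ofReal_rpow_of_nonneg (by positivity)
      hpp.nonneg, ← Real.rpow_mul (norm_nonneg _), hpp.symm.sub_one_mul_conj,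
      ← ENNReal.ofReal_rpow_of_nonneg (norm_nonneg _) hpp.symm.nonneg, ofReal_norm]
  · rw [holderExtremal, indicator_of_notMem hz, indicator_of_notMem hz, enorm_zero,
      ENNReal.zero_rpow_of_pos hpp.pos]

theorem enorm_integral_conj_holderExtremal_mul (hp' : 1 < p') {S : Set α} (hS : MeasurableSet S)
    {u : α → ℂ} (hu : Measurable u) (hfin : ∫⁻ z in S, ‖u z‖ₑ ^ p' ∂ν ≠ ∞) :
    ‖∫ z, conj (holderExtremal p' S u z) * u z ∂ν‖ₑ = ∫⁻ z in S, ‖u z‖ₑ ^ p' ∂ν := by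
  have hnonneg : 0 ≤ᵐ[ν.restrict S] fun z => ‖u z‖ ^ p' :=
    Eventually.of_forall fun z => by positivity
  have henorm : ∀ z, ENNReal.ofReal (‖u z‖ ^ p') = ‖u z‖ₑ ^ p' := fun z => by
    rw [← ENNReal.ofReal_rpow_of_nonneg (norm_nonneg _) (by linarith), ofReal_norm]
  have hpointwise : ∀ z, conj (holderExtremal p' S u z) * u z =
      S.indicator (fun z => ((‖u z‖ ^ p' : ℝ) : ℂ)) z := fun z => by
    by_cases hz : z ∈ S
    · rw [holderExtremal, indicator_of_mem hz, indicator_of_mem hz,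
        conj_mul_norm_rpow_sub_two_mul_self hp']
    · rw [holderExtremal, indicator_of_notMem hz, indicator_of_notMem hz, map_zero, zero_mul]
  simp_rw [hpointwise]
  rw [integral_indicator hS, integral_complex_ofReal, ← ofReal_norm, Complex.norm_real,
    Real.norm_of_nonneg (integral_nonneg_of_ae hnonneg),
    integral_eq_lintegral_of_nonneg_ae hnonneg (hu.norm.pow_const _).aestronglyMeasurable]
  simp_rw [henorm]
  exact ENNReal.ofReal_toReal hfin

theorem exists_monotone_bounded_exhaustion {u : α → ℂ} (hu : Measurable u) (hu2 : MemLp u 2 ν) :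
    ∃ S : ℕ → Set α, Monotone S ∧ (∀ n, MeasurableSet (S n)) ∧ (∀ n, ν (S n) < ∞) ∧
      (∀ n, ∀ z ∈ S n, ‖u z‖ ≤ n) ∧ Function.support u ⊆ ⋃ n, S n := by
  refine ⟨fun n => {z | (n : ℝ≥0∞)⁻¹ ≤ ‖u z‖ₑ ∧ ‖u z‖ ≤ n}, fun m n hmn z hz => ?_, fun n => ?_,
    fun n => ?_, fun n z hz => hz.2, fun z hz => ?_⟩
  · exact ⟨(ENNReal.inv_le_inv.2 (Nat.cast_le.2 hmn)).trans hz.1, hz.2.trans (Nat.cast_le.2 hmn)⟩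
  · exact (measurableSet_le measurable_const hu.enorm).inter
      (measurableSet_le hu.norm measurable_const)
  · exact (measure_mono fun z hz => hz.1).trans_lt (hu2.meas_ge_lt_top' two_ne_zero
      ENNReal.ofNat_ne_top (ENNReal.inv_ne_zero.2 (ENNReal.natCast_ne_top n)))
  · obtain ⟨m, hm⟩ := ENNReal.exists_inv_nat_lt (enorm_ne_zero.2 hz)
    obtain ⟨n, hn⟩ := exists_nat_ge ‖u z‖
    refine mem_iUnion.2 ⟨max m n, ?_, hn.trans (Nat.cast_le.2 (le_max_right m n))⟩
    exact (ENNReal.inv_le_inv.2 (Nat.cast_le.2 (le_max_left m n))).trans hm.le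

theorem setLIntegral_enorm_rpow_ne_top {S : Set α} (hSν : ν S ≠ ∞) {u : α → ℂ} {b : ℝ}
    (hb : ∀ z ∈ S, ‖u z‖ ≤ b) (hp : 0 ≤ p) : ∫⁻ z in S, ‖u z‖ₑ ^ p ∂ν ≠ ∞ := by
  refine (setLIntegral_lt_top_of_le_nnreal hSν ⟨b.toNNReal ^ p, fun z hz => ?_⟩).ne
  rw [ENNReal.coe_rpow_of_nonneg _ hp, ← ofReal_norm]
  exact ENNReal.rpow_le_rpow (ENNReal.ofReal_le_ofReal (hb z hz)) hp

theorem eLpNorm_le_of_forall_enorm_integral_conj_mul_le (hpp : p.HolderConjugate p') {u : α → ℂ}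
    (hu : Measurable u) (hu2 : MemLp u 2 ν) {M : ℝ≥0∞}
    (h : ∀ g : α → ℂ, MemLp g 2 ν → MemLp g (ENNReal.ofReal p) ν →
      ‖∫ z, conj (g z) * u z ∂ν‖ₑ ≤ M * eLpNorm g (ENNReal.ofReal p) ν) :
    eLpNorm u (ENNReal.ofReal p') ν ≤ M := by
  obtain ⟨S, hS_mono, hS_meas, hS_finite, hS_bound, hS_cover⟩ :=
    exists_monotone_bounded_exhaustion hu hu2
  have htruncated : ∀ n, (∫⁻ z in S n, ‖u z‖ₑ ^ p' ∂ν) ^ (1 / p') ≤ M := by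
    intro n
    have hfin := setLIntegral_enorm_rpow_ne_top (hS_finite n).ne (hS_bound n) hpp.symm.nonneg
    have hg := memLp_holderExtremal hpp.symm.lt (hS_meas n) (hS_finite n).ne hu (hS_bound n)
    have hpair := h _ (hg 2) (hg _)
    rw [enorm_integral_conj_holderExtremal_mul hpp.symm.lt (hS_meas n) hu hfin,
      eLpNorm_ofReal_eq_lintegral_rpow hpp.pos,
      lintegral_enorm_holderExtremal_rpow hpp (hS_meas n)] at hpair
    exact rpow_one_div_le_of_le_mul_rpow hpp hfin hpair
  have hsupport : Function.support (fun z => ‖u z‖ₑ ^ p') ⊆ ⋃ n, S n := fun z hz =>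
    hS_cover fun h0 => hz (by simp [h0, hpp.symm.pos])
  have hexhaust : ∫⁻ z, ‖u z‖ₑ ^ p' ∂ν = ⨆ n, ∫⁻ z in S n, ‖u z‖ₑ ^ p' ∂ν := by
    rw [← setLIntegral_iUnion_of_directed _ hS_mono.directed_le,
      ← lintegral_indicator (MeasurableSet.iUnion hS_meas), indicator_eq_self.2 hsupport]
  rw [eLpNorm_ofReal_eq_lintegral_rpow hpp.symm.pos, hexhaust, one_div,
    ENNReal.rpow_inv_le_iff hpp.symm.pos]
  refine iSup_le fun n => ?_
  rw [← ENNReal.rpow_inv_le_iff hpp.symm.pos, ← one_div]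
  exact htruncated n

theorem enorm_inner_le_eLpNorm_mul_eLpNorm (hpp : p.HolderConjugate p') (F G : Lp ℂ 2 ν) :
    ‖inner ℂ F G‖ₑ ≤ eLpNorm F (ENNReal.ofReal p) ν * eLpNorm G (ENNReal.ofReal p') ν := by
  rw [L2.inner_def, eLpNorm_ofReal_eq_lintegral_rpow hpp.pos,
    eLpNorm_ofReal_eq_lintegral_rpow hpp.symm.pos]
  calc ‖∫ z, inner ℂ (F z) (G z) ∂ν‖ₑ ≤ ∫⁻ z, ‖F z‖ₑ * ‖G z‖ₑ ∂ν := by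
        refine (enorm_integral_le_lintegral_enorm _).trans_eq (lintegral_congr fun z => ?_)
        rw [RCLike.inner_apply, enorm_mul, RCLike.enorm_conj, mul_comm]
    _ ≤ _ := ENNReal.lintegral_mul_le_Lp_mul_Lq ν hpp (Lp.aestronglyMeasurable F).enorm
        (Lp.aestronglyMeasurable G).enorm

theorem BergmanProjectionLpBounded.of_holderConjugate {E : Type*} [NormedAddCommGroup E]
    [NormedSpace ℂ E] [MeasureSpace E] {Ω : Set E} {μ : E → ℝ}
    [(bergmanSpace Ω μ).HasOrthogonalProjection] (hpp : p.HolderConjugate p')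
    (h : BergmanProjectionLpBounded Ω μ p) : BergmanProjectionLpBounded Ω μ p' := by
  obtain ⟨C, hC⟩ := h
  refine ⟨C, fun f _ => ?_⟩
  refine eLpNorm_le_of_forall_enorm_integral_conj_mul_le hpp (Lp.stronglyMeasurable _).measurable
    (Lp.memLp _) fun g hg2 hgp => ?_
  have hg := hg2.coeFn_toLp
  have hpair : ∫ z, conj (g z) * bergmanProjection Ω μ f z ∂weightedMeasure Ω μ =
      inner ℂ (bergmanProjection Ω μ (hg2.toLp g)) f := by
    rw [bergmanProjection, Submodule.inner_starProjection_left_eq_right, L2.inner_def]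
    refine integral_congr_ae (hg.mono fun z hz => ?_)
    simp only [hz, RCLike.inner_apply, mul_comm]
  calc _ ≤ eLpNorm (bergmanProjection Ω μ (hg2.toLp g)) (ENNReal.ofReal p) (weightedMeasure Ω μ) *
        eLpNorm f (ENNReal.ofReal p') (weightedMeasure Ω μ) := by
        rw [hpair]
        exact enorm_inner_le_eLpNorm_mul_eLpNorm hpp _ _
    _ ≤ C * eLpNorm g (ENNReal.ofReal p) (weightedMeasure Ω μ) *
        eLpNorm f (ENNReal.ofReal p') (weightedMeasure Ω μ) := by
        rw [← eLpNorm_congr_ae hg]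
        gcongr
        exact hC _ (hgp.ae_eq hg.symm)
    _ = _ := by ring

end Duality

section Boundedness

/-- A positive kernel comparable to the modulus of the Bergman kernel of the disc, the factor
`|w| ^ a |η| ^ a` taking account of a zero of order `a` at the origin. -/
noncomputable def diskSchurKernel (a : ℝ) (w η : ℂ) : ℝ≥0∞ :=
  ENNReal.ofReal (‖w‖ ^ a * ‖η‖ ^ a * (‖1 - w * conj η‖ ^ 2)⁻¹)

/-- The test function for Schur's test on the disc; `α` governs the growth at the boundary and `σ`
the behaviour at the origin. -/
noncomputable def diskSchurWeight (α σ : ℝ) (η : ℂ) : ℝ≥0∞ :=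
  ENNReal.ofReal ((1 - ‖η‖) ^ (-α) * ‖η‖ ^ σ)

theorem measurable_diskSchurKernel (a : ℝ) : Measurable (Function.uncurry (diskSchurKernel a)) := by
  unfold diskSchurKernel Function.uncurry
  have : Measurable fun x : ℂ × ℂ => ‖1 - x.1 * conj x.2‖ := by fun_prop
  fun_prop

theorem measurable_diskSchurWeight (α σ : ℝ) : Measurable (diskSchurWeight α σ) := by
  unfold diskSchurWeight
  fun_prop

theorem diskSchurKernel_comm (a : ℝ) (w η : ℂ) : diskSchurKernel a w η = diskSchurKernel a η w := by
  have hconj : ‖1 - w * conj η‖ = ‖1 - η * conj w‖ := by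
    rw [← RCLike.norm_conj]
    simp [mul_comm]
  rw [diskSchurKernel, diskSchurKernel, hconj, mul_comm (‖w‖ ^ a)]

theorem diskSchurWeight_rpow {α σ s : ℝ} (hs : 0 ≤ s) {η : ℂ} (hη : η ∈ ball (0 : ℂ) 1) :
    diskSchurWeight α σ η ^ s = diskSchurWeight (α * s) (σ * s) η := by
  have hη' : 0 ≤ 1 - ‖η‖ := sub_nonneg.2 (mem_ball_zero_iff.1 hη).le
  rw [diskSchurWeight, diskSchurWeight, ENNReal.ofReal_rpow_of_nonneg (by positivity) hs,
    Real.mul_rpow (by positivity) (by positivity), ← Real.rpow_mul hη',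
    ← Real.rpow_mul (norm_nonneg _), neg_mul]

theorem diskSchurWeight_ne_zero (α σ : ℝ) {η : ℂ} (hη : η ∈ ball (0 : ℂ) 1) (h0 : η ≠ 0) :
    diskSchurWeight α σ η ≠ 0 := by
  have : 0 < 1 - ‖η‖ := sub_pos.2 (mem_ball_zero_iff.1 hη)
  exact (ENNReal.ofReal_pos.2 (by positivity)).ne'

theorem lintegral_diskSchurKernel_mul_diskSchurWeight (a α σ e : ℝ) (w : ℂ) :
    ∫⁻ η, diskSchurKernel a w η * diskSchurWeight α σ η ∂diskMeasure e =
      ENNReal.ofReal (‖w‖ ^ a) * ∫⁻ η in ball (0 : ℂ) 1, ENNReal.ofReal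
        (‖η‖ ^ (a + σ - e) * (1 - ‖η‖) ^ (-α) * (‖1 - w * conj η‖ ^ 2)⁻¹) := by
  have hne : ∀ᵐ η : ℂ, η ≠ 0 := Measure.ae_ne volume 0
  have hmeas : Measurable fun η => diskSchurKernel a w η * diskSchurWeight α σ η :=
    (measurable_diskSchurKernel a).of_uncurry_left.mul (measurable_diskSchurWeight α σ)
  rw [lintegral_diskMeasure _ hmeas, ← lintegral_const_mul' _ _ ENNReal.ofReal_ne_top]
  refine setLIntegral_congr_fun_ae measurableSet_ball (hne.mono fun η hη0 hη => ?_)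
  have : 0 ≤ 1 - ‖η‖ := sub_nonneg.2 (mem_ball_zero_iff.1 hη).le
  have hpow : ‖η‖ ^ (a + σ - e) = ‖η‖ ^ (-e) * ‖η‖ ^ a * ‖η‖ ^ σ := by
    rw [← Real.rpow_add (norm_pos_iff.2 hη0), ← Real.rpow_add (norm_pos_iff.2 hη0)]
    ring_nf
  rw [diskSchurKernel, diskSchurWeight, ← ENNReal.ofReal_mul (by positivity),
    ← ENNReal.ofReal_mul (by positivity), ← ENNReal.ofReal_mul (by positivity), hpow]
  ring_nf

theorem exists_lintegral_diskSchurKernel_mul_le {a α σ e : ℝ} (hα0 : 0 < α) (hα1 : α < 1)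
    (hσ : σ ≤ a) (he : e < 2 + a + σ) :
    ∃ C : ℝ≥0, ∀ᵐ w ∂diskMeasure e,
      ∫⁻ η, diskSchurKernel a w η * diskSchurWeight α σ η ∂diskMeasure e ≤
        C * diskSchurWeight α σ w := by
  obtain ⟨C, hC⟩ := exists_lintegral_forelliRudin_le (κ := a + σ - e) hα0 hα1 (by linarith)
  refine ⟨C, ?_⟩
  filter_upwards [ae_diskMeasure_mem e, ae_diskMeasure_ne_zero e] with w hw hw0
  have hpow : ‖w‖ ^ a ≤ ‖w‖ ^ σ :=
    Real.rpow_le_rpow_of_exponent_ge (norm_pos_iff.2 hw0) (mem_ball_zero_iff.1 hw).le hσ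
  calc _ ≤ ENNReal.ofReal (‖w‖ ^ σ) * (C * ENNReal.ofReal ((1 - ‖w‖) ^ (-α))) := by
        rw [lintegral_diskSchurKernel_mul_diskSchurWeight]
        gcongr
        exact hC w hw
    _ = C * diskSchurWeight α σ w := by
        rw [diskSchurWeight, ENNReal.ofReal_mul' (by positivity)]
        ring

theorem exists_lintegral_diskSchurKernel_mul_rpow_le {a α σ e s : ℝ} (hs : 0 ≤ s)
    (hα0 : 0 < α * s) (hα1 : α * s < 1) (hσ : σ * s ≤ a) (he : e < 2 + a + σ * s) :
    ∃ C : ℝ≥0, ∀ᵐ w ∂diskMeasure e,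
      ∫⁻ η, diskSchurKernel a w η * diskSchurWeight α σ η ^ s ∂diskMeasure e ≤
        C * diskSchurWeight α σ w ^ s := by
  obtain ⟨C, hC⟩ := exists_lintegral_diskSchurKernel_mul_le hα0 hα1 hσ he
  refine ⟨C, ?_⟩
  filter_upwards [hC, ae_diskMeasure_mem e] with w hw hw_mem
  rw [diskSchurWeight_rpow hs hw_mem]
  refine (lintegral_congr_ae ((ae_diskMeasure_mem e).mono fun η hη => ?_)).trans_le hw
  simp only [diskSchurWeight_rpow hs hη]

/-- The product kernel dominating `bidiskKernel`. -/
noncomputable def bidiskSchurKernel (w η : ℂ × ℂ) : ℝ≥0∞ :=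
  diskSchurKernel 0 w.1 η.1 * diskSchurKernel 1 w.2 η.2

/-- The test function for Schur's test on the bidisc. -/
noncomputable def bidiskSchurWeight (σ : ℝ) (w : ℂ × ℂ) : ℝ≥0∞ :=
  diskSchurWeight (σ / 2) 0 w.1 * diskSchurWeight (σ / 2) σ w.2

theorem measurable_bidiskSchurKernel : Measurable (Function.uncurry bidiskSchurKernel) := by
  have : Measurable fun x : (ℂ × ℂ) × (ℂ × ℂ) => ‖1 - x.1.1 * conj x.2.1‖ := by fun_prop
  have : Measurable fun x : (ℂ × ℂ) × (ℂ × ℂ) => ‖1 - x.1.2 * conj x.2.2‖ := by fun_prop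
  unfold bidiskSchurKernel diskSchurKernel Function.uncurry
  fun_prop

theorem measurable_bidiskSchurWeight (σ : ℝ) : Measurable (bidiskSchurWeight σ) :=
  ((measurable_diskSchurWeight _ _).comp measurable_fst).mul
    ((measurable_diskSchurWeight _ _).comp measurable_snd)

theorem bidiskSchurKernel_comm (w η : ℂ × ℂ) : bidiskSchurKernel w η = bidiskSchurKernel η w := by
  rw [bidiskSchurKernel, bidiskSchurKernel, diskSchurKernel_comm 0, diskSchurKernel_comm 1]

theorem ae_bidiskSchurWeight_ne_zero (q σ : ℝ) :
    ∀ᵐ w ∂bidiskMeasure q, bidiskSchurWeight σ w ≠ 0 := by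
  filter_upwards [ae_bidiskMeasure_of_ae (q := q)
    ((ae_diskMeasure_mem 0).and (ae_diskMeasure_ne_zero 0))
    ((ae_diskMeasure_mem _).and (ae_diskMeasure_ne_zero _))] with w ⟨⟨h1, h1'⟩, ⟨h2, h2'⟩⟩
  exact mul_ne_zero (diskSchurWeight_ne_zero _ _ h1 h1') (diskSchurWeight_ne_zero _ _ h2 h2')

theorem bidiskSchurWeight_ne_top (σ : ℝ) (w : ℂ × ℂ) : bidiskSchurWeight σ w ≠ ∞ :=
  ENNReal.mul_ne_top ENNReal.ofReal_ne_top ENNReal.ofReal_ne_top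

theorem exists_lintegral_bidiskSchurKernel_mul_rpow_le {q σ s : ℝ} (hs : 0 ≤ s) (h0 : 0 < σ * s)
    (hq : q - 1 < σ * s) (h1 : σ * s ≤ 1) :
    ∃ C : ℝ≥0, ∀ᵐ w ∂bidiskMeasure q,
      ∫⁻ η, bidiskSchurKernel w η * bidiskSchurWeight σ η ^ s ∂bidiskMeasure q ≤
        C * bidiskSchurWeight σ w ^ s := by
  obtain ⟨C₁, hC₁⟩ := exists_lintegral_diskSchurKernel_mul_rpow_le (a := 0) (α := σ / 2) (σ := 0)
    (e := 0) hs (by linarith) (by linarith) (by simp) (by simp)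
  obtain ⟨C₂, hC₂⟩ := exists_lintegral_diskSchurKernel_mul_rpow_le (a := 1) (α := σ / 2) (σ := σ)
    (e := q + 2) hs (by linarith) (by linarith) h1 (by linarith)
  refine ⟨C₁ * C₂, ?_⟩
  filter_upwards [ae_bidiskMeasure_of_ae hC₁ hC₂] with w ⟨hw1, hw2⟩
  have hmeas : ∀ a α σ w, Measurable fun η => diskSchurKernel a w η * diskSchurWeight α σ η ^ s :=
    fun a α σ w => (measurable_diskSchurKernel a).of_uncurry_left.mul
      ((measurable_diskSchurWeight α σ).pow_const s)
  calc _ = ∫⁻ η, (diskSchurKernel 0 w.1 η.1 * diskSchurWeight (σ / 2) 0 η.1 ^ s) *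
        (diskSchurKernel 1 w.2 η.2 * diskSchurWeight (σ / 2) σ η.2 ^ s) ∂bidiskMeasure q := by
        refine lintegral_congr fun η => ?_
        rw [bidiskSchurKernel, bidiskSchurWeight, ENNReal.mul_rpow_of_nonneg _ _ hs]
        ring
    _ ≤ (C₁ * diskSchurWeight (σ / 2) 0 w.1 ^ s) * (C₂ * diskSchurWeight (σ / 2) σ w.2 ^ s) := by
        rw [bidiskMeasure, lintegral_prod_mul (hmeas _ _ _ w.1).aemeasurable
          (hmeas _ _ _ w.2).aemeasurable]
        gcongr
    _ = _ := by
        rw [bidiskSchurWeight, ENNReal.mul_rpow_of_nonneg _ _ hs, ENNReal.coe_mul]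
        ring

theorem enorm_bidiskKernel_le (q : ℝ) {w η : ℂ × ℂ} (hw1 : w.1 ∈ ball (0 : ℂ) 1)
    (hw2 : w.2 ∈ ball (0 : ℂ) 1) (hη1 : η.1 ∈ ball (0 : ℂ) 1) (hη2 : η.2 ∈ ball (0 : ℂ) 1) :
    ‖bidiskKernel q w η‖ₑ ≤ ENNReal.ofReal (1 + |q|) * bidiskSchurKernel w η := by
  rw [mem_ball_zero_iff] at hw1 hw2 hη1 hη2
  have hfst := norm_diskKernel_le 0 (norm_mul_conj_lt_one hw1 hη1)
  have hsnd := norm_diskKernel_le q (norm_mul_conj_lt_one hw2 hη2)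
  rw [abs_zero, add_zero, one_mul] at hfst
  rw [bidiskSchurKernel, diskSchurKernel, diskSchurKernel, ← ENNReal.ofReal_mul (by positivity),
    ← ENNReal.ofReal_mul (by positivity), ← ofReal_norm]
  refine ENNReal.ofReal_le_ofReal ?_
  calc ‖bidiskKernel q w η‖ = ‖diskKernel 0 (w.1 * conj η.1)‖ *
        (‖w.2‖ * ‖η.2‖ * ‖diskKernel q (w.2 * conj η.2)‖) := by
        rw [bidiskKernel, norm_mul, norm_mul, norm_mul, RCLike.norm_conj]
    _ ≤ (‖1 - w.1 * conj η.1‖ ^ 2)⁻¹ *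
        (‖w.2‖ * ‖η.2‖ * ((1 + |q|) * (‖1 - w.2 * conj η.2‖ ^ 2)⁻¹)) := by gcongr
    _ = _ := by
        simp only [Real.rpow_zero, Real.rpow_one]
        ring

theorem ae_enorm_bergmanProjection_le {q : ℝ} (hq1 : 1 ≤ q) (hq2 : q < 2)
    (f : Lp ℂ 2 (hartogsMeasure q)) :
    ∀ᵐ w ∂bidiskMeasure q,
      ‖bergmanProjection hartogsTriangle (hartogsWeight (-(q + 4))) f (hartogsMap w)‖ₑ ≤
        ENNReal.ofReal (1 + |q|) *
          ∫⁻ η, bidiskSchurKernel w η * ‖f (hartogsMap η)‖ₑ ∂bidiskMeasure q := by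
  filter_upwards [ae_bergmanProjection_eq_integral hq1 hq2 f, ae_bidiskMeasure_mem q]
    with w hw ⟨hw1, hw2, _⟩
  rw [hw, ← lintegral_const_mul' _ _ ENNReal.ofReal_ne_top]
  refine (enorm_integral_le_lintegral_enorm _).trans (lintegral_mono_ae ?_)
  filter_upwards [ae_bidiskMeasure_mem q] with η ⟨hη1, hη2, _⟩
  rw [enorm_mul, ← mul_assoc]
  gcongr
  exact enorm_bidiskKernel_le q hw1 hw2 hη1 hη2

theorem bergmanProjectionLpBounded_of_schur {q p p' : ℝ} (hq1 : 1 ≤ q) (hq2 : q < 2)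
    (hpp : p.HolderConjugate p') {A B : ℝ≥0} {σ : ℝ}
    (hA : ∀ᵐ w ∂bidiskMeasure q, ∫⁻ η, bidiskSchurKernel w η * bidiskSchurWeight σ η ^ p'
      ∂bidiskMeasure q ≤ A * bidiskSchurWeight σ w ^ p')
    (hB : ∀ᵐ w ∂bidiskMeasure q, ∫⁻ η, bidiskSchurKernel w η * bidiskSchurWeight σ η ^ p
      ∂bidiskMeasure q ≤ B * bidiskSchurWeight σ w ^ p) :
    BergmanProjectionLpBounded hartogsTriangle (hartogsWeight (-(q + 4))) p := by
  have hP := measurePreserving_hartogsMap q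
  set N : ℝ≥0 := (1 + |q|).toNNReal ^ p * (A ^ (p / p') * B)
  refine ⟨N ^ (1 / p), fun f _ => ?_⟩
  set u := bergmanProjection hartogsTriangle (hartogsWeight (-(q + 4))) f
  have hf : AEMeasurable (fun w => ‖f (hartogsMap w)‖ₑ) (bidiskMeasure q) :=
    ((Lp.aestronglyMeasurable f).comp_measurePreserving hP).enorm
  have hSchur := lintegral_rpow_le_of_schur hpp measurable_bidiskSchurKernel
    (measurable_bidiskSchurWeight σ) (measurable_bidiskSchurWeight σ)
    (ae_bidiskSchurWeight_ne_zero q σ) (Eventually.of_forall (bidiskSchurWeight_ne_top σ)) hA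
    (by simpa only [bidiskSchurKernel_comm] using hB) hf
  have hmain : ∫⁻ w, ‖u (hartogsMap w)‖ₑ ^ p ∂bidiskMeasure q ≤
      N * ∫⁻ w, ‖f (hartogsMap w)‖ₑ ^ p ∂bidiskMeasure q := by
    calc _ ≤ ∫⁻ w, ENNReal.ofReal (1 + |q|) ^ p *
          (∫⁻ η, bidiskSchurKernel w η * ‖f (hartogsMap η)‖ₑ ∂bidiskMeasure q) ^ p
            ∂bidiskMeasure q := by
          refine lintegral_mono_ae ((ae_enorm_bergmanProjection_le hq1 hq2 f).mono fun w hw => ?_)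
          rw [← ENNReal.mul_rpow_of_nonneg _ _ hpp.nonneg]
          exact ENNReal.rpow_le_rpow hw hpp.nonneg
      _ ≤ ENNReal.ofReal (1 + |q|) ^ p * ((A : ℝ≥0∞) ^ (p / p') * B *
          ∫⁻ w, ‖f (hartogsMap w)‖ₑ ^ p ∂bidiskMeasure q) := by
          rw [lintegral_const_mul' _ _
            (ENNReal.rpow_ne_top_of_nonneg hpp.nonneg ENNReal.ofReal_ne_top)]
          gcongr
      _ = _ := by
          rw [ENNReal.coe_mul, ENNReal.coe_mul, ENNReal.coe_rpow_of_nonneg _ hpp.nonneg,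
            ENNReal.coe_rpow_of_nonneg _ (div_nonneg hpp.nonneg hpp.symm.nonneg), ENNReal.ofReal]
          ring
  rw [← eLpNorm_comp_measurePreserving (Lp.aestronglyMeasurable _) hP,
    ← eLpNorm_comp_measurePreserving (Lp.aestronglyMeasurable _) hP,
    eLpNorm_ofReal_eq_lintegral_rpow hpp.pos, eLpNorm_ofReal_eq_lintegral_rpow hpp.pos,
    ENNReal.coe_rpow_of_nonneg _ hpp.one_div_nonneg,
    ← ENNReal.mul_rpow_of_nonneg _ _ hpp.one_div_nonneg]
  exact ENNReal.rpow_le_rpow hmain hpp.one_div_nonneg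

theorem bergmanProjectionLpBounded_of_lt_of_le_two {q p : ℝ} (hq1 : 1 ≤ q) (hqp : q < p)
    (hp2 : p ≤ 2) : BergmanProjectionLpBounded hartogsTriangle (hartogsWeight (-(q + 4))) p := by
  have hpp := Real.HolderConjugate.conjExponent (hq1.trans_lt hqp)
  set p' := p.conjExponent
  have hσp' : 1 / p' * p' = 1 := one_div_mul_cancel hpp.symm.ne_zero
  have hσp : 1 / p' * p = p - 1 := by rw [one_div_mul_eq_div, hpp.div_conj_eq_sub_one]
  obtain ⟨A, hA⟩ := exists_lintegral_bidiskSchurKernel_mul_rpow_le (q := q) (σ := 1 / p')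
    hpp.symm.nonneg (by linarith) (by linarith) hσp'.le
  obtain ⟨B, hB⟩ := exists_lintegral_bidiskSchurKernel_mul_rpow_le (q := q) (σ := 1 / p')
    hpp.nonneg (by linarith) (by linarith) (by linarith)
  exact bergmanProjectionLpBounded_of_schur hq1 (hqp.trans_le hp2) hpp hA hB

theorem mul_lt_add_iff_lt_of_holderConjugate {p p' q : ℝ} (hpp : p.HolderConjugate p') :
    p * q < p + q ↔ q < p' := by
  rw [hpp.conjugate_eq, lt_div_iff₀ hpp.sub_one_pos, mul_sub_one, sub_lt_iff_lt_add, mul_comm]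

theorem bergmanProjectionLpBounded_of_lt {q p : ℝ} (hq1 : 1 ≤ q) (hqp : q < p)
    (hpq : p * q < p + q) :
    BergmanProjectionLpBounded hartogsTriangle (hartogsWeight (-(q + 4))) p := by
  rcases le_or_gt p 2 with hp2 | hp2
  · exact bergmanProjectionLpBounded_of_lt_of_le_two hq1 hqp hp2
  have hpp := Real.HolderConjugate.conjExponent (hq1.trans_lt hqp)
  have hp'2 : p.conjExponent ≤ 2 := by
    rw [hpp.conjugate_eq, div_le_iff₀ hpp.sub_one_pos]
    linarith
  exact (bergmanProjectionLpBounded_of_lt_of_le_two hq1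
    ((mul_lt_add_iff_lt_of_holderConjugate hpp).1 hpq) hp'2).of_holderConjugate hpp.symm

end Boundedness

section Unboundedness

theorem integrableOn_ball_norm_rpow {κ : ℝ} (hκ : -2 < κ) :
    IntegrableOn (fun η : ℂ => ((‖η‖ ^ κ : ℝ) : ℂ)) (ball 0 1) := by
  have hmeas : Measurable fun η : ℂ => ((‖η‖ ^ κ : ℝ) : ℂ) := by fun_prop
  refine ⟨hmeas.aestronglyMeasurable, ?_⟩
  refine lt_of_eq_of_lt (lintegral_congr fun η => ?_)
    (lintegral_ball_ofReal_norm_rpow_lt_top_iff.2 hκ)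
  rw [← ofReal_norm, Complex.norm_real, Real.norm_of_nonneg (by positivity)]

theorem integral_Ioo_mul_rpow {κ : ℝ} (hκ : -2 < κ) :
    ∫ r in Ioo (0 : ℝ) 1, r * r ^ κ = (κ + 2)⁻¹ := by
  have hpow : ∀ r ∈ Ioo (0 : ℝ) 1, r * r ^ κ = r ^ (κ + 1) := fun r hr => by
    rw [Real.rpow_add_one hr.1.ne', mul_comm]
  rw [setIntegral_congr_fun measurableSet_Ioo hpow, ← integral_Ioc_eq_integral_Ioo,
    ← intervalIntegral.integral_of_le zero_le_one, integral_rpow (Or.inl (by linarith)),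
    Real.one_rpow, Real.zero_rpow (by linarith)]
  ring

theorem integral_mul_diskKernel_mul_norm_rpow {q m : ℝ} (hm : -2 < m - q) {w : ℂ}
    (hw : w ∈ ball (0 : ℂ) 1) :
    ∫ η, w * conj η * diskKernel q (w * conj η) * (η * (‖η‖ ^ m : ℝ)) ∂diskMeasure (q + 2) =
      ((2 - q) / (m - q + 2) : ℝ) * w := by
  have hne : ∀ᵐ η : ℂ, η ≠ 0 := Measure.ae_ne volume 0
  calc _ = ∫ η in ball (0 : ℂ) 1, w * (diskKernel q (w * conj η) * (‖η‖ ^ (m - q) : ℝ)) := by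
        rw [integral_diskMeasure]
        refine integral_congr_ae (ae_restrict_of_ae (hne.mono fun η hη => ?_))
        have hpow : ‖η‖ ^ (m - q) = ‖η‖ ^ (-q) * ‖η‖ ^ m := by
          rw [← Real.rpow_add (norm_pos_iff.2 hη)]
          ring_nf
        calc _ = w * diskKernel q (w * conj η) * (η * (conj η * (‖η‖ ^ (-(q + 2)) : ℝ))) *
              (‖η‖ ^ m : ℝ) := by ring
          _ = _ := by
            simp only [conj_mul_norm_rpow q hη, mul_inv_cancel_left₀ hη, hpow]
            push_cast
            ring
    _ = w * ((2 - q) * ∫ r in Ioo (0 : ℝ) 1, r * r ^ (m - q) : ℝ) := by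
        rw [integral_const_mul, integral_diskKernel_mul_radial q hw (ψ := fun r => r ^ (m - q))
          (integrableOn_diskKernel_mul q hw (integrableOn_ball_norm_rpow hm))]
    _ = _ := by rw [integral_Ioo_mul_rpow hm, ← div_eq_mul_inv, mul_comm]

theorem memLp_hartogsMeasure_snd_mul_norm_rpow_iff {q m p : ℝ} (hp : 0 < p) :
    MemLp (fun z : ℂ × ℂ => z.2 * (‖z.2‖ ^ m : ℝ)) (ENNReal.ofReal p) (hartogsMeasure q) ↔
      q < (1 + m) * p := by
  have hmeas : Measurable fun z : ℂ × ℂ => z.2 * ((‖z.2‖ ^ m : ℝ) : ℂ) := by fun_prop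
  rw [← memLp_comp_hartogsMap_iff hmeas.aestronglyMeasurable, ← memLp_snd_mul_norm_rpow_iff hp]
  rfl

theorem ae_bergmanProjection_snd_mul_norm_rpow {q m : ℝ} (hq1 : 1 ≤ q) (hq2 : q < 2)
    (hm : -2 < m - q) {f : Lp ℂ 2 (hartogsMeasure q)}
    (hf : f =ᵐ[hartogsMeasure q] fun z => z.2 * (‖z.2‖ ^ m : ℝ)) :
    ∀ᵐ w ∂bidiskMeasure q,
      bergmanProjection hartogsTriangle (hartogsWeight (-(q + 4))) f (hartogsMap w) =
        ((2 - q) / (m - q + 2) : ℝ) * w.2 := by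
  have hone : Integrable (fun _ : ℂ => (1 : ℂ)) (diskMeasure 0) := by
    rw [integrable_diskMeasure_iff]
    simp
  have hf' : ∀ᵐ w ∂bidiskMeasure q, f (hartogsMap w) = w.2 * (‖w.2‖ ^ m : ℝ) :=
    (measurePreserving_hartogsMap q).quasiMeasurePreserving.ae hf
  filter_upwards [ae_bergmanProjection_eq_integral hq1 hq2 f, ae_bidiskMeasure_mem q]
    with w hw ⟨hw1, hw2, _⟩
  have hfst := integral_diskKernel_zero_mul (G := fun _ => 1) (differentiableOn_const _) hone hw1
  calc _ = ∫ η, diskKernel 0 (w.1 * conj η.1) * 1 * (w.2 * conj η.2 *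
          diskKernel q (w.2 * conj η.2) * (η.2 * (‖η.2‖ ^ m : ℝ))) ∂bidiskMeasure q := by
        rw [hw]
        refine integral_congr_ae (hf'.mono fun η hη => ?_)
        simp only [hη, bidiskKernel, mul_one, mul_assoc]
    _ = _ := by
        rw [bidiskMeasure, integral_prod_mul (fun η : ℂ => diskKernel 0 (w.1 * conj η) * 1)
          (fun η : ℂ => w.2 * conj η * diskKernel q (w.2 * conj η) * (η * (‖η‖ ^ m : ℝ))),
          hfst, one_mul, integral_mul_diskKernel_mul_norm_rpow hm hw2]

theorem lt_of_bergmanProjectionLpBounded {q p : ℝ} (hq1 : 1 ≤ q) (hq2 : q < 2) (hp : 0 < p)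
    (h : BergmanProjectionLpBounded hartogsTriangle (hartogsWeight (-(q + 4))) p) : q < p := by
  obtain ⟨C, hC⟩ := h
  have hm : 0 < q / p := by positivity
  have hmp : q < (1 + q / p) * p := by
    rw [one_add_mul, div_mul_cancel₀ _ hp.ne']
    linarith
  have hfp := (memLp_hartogsMeasure_snd_mul_norm_rpow_iff hp).2 hmp
  have hf2 : MemLp (fun z : ℂ × ℂ => z.2 * (‖z.2‖ ^ (q / p) : ℝ)) 2 (hartogsMeasure q) := by
    simpa using (memLp_hartogsMeasure_snd_mul_norm_rpow_iff (q := q) (m := q / p) two_pos).2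
      (by linarith)
  have hBf : MemLp (bergmanProjection hartogsTriangle (hartogsWeight (-(q + 4))) (hf2.toLp _))
      (ENNReal.ofReal p) (hartogsMeasure q) := by
    have hfp' := hfp.ae_eq hf2.coeFn_toLp.symm
    exact ⟨Lp.aestronglyMeasurable _,
      (hC _ hfp').trans_lt (ENNReal.mul_lt_top ENNReal.coe_lt_top hfp'.2)⟩
  set c := (((2 - q) / (q / p - q + 2) : ℝ) : ℂ)
  have hc0 : c ≠ 0 := Complex.ofReal_ne_zero.2 (div_pos (by linarith) (by linarith)).ne'
  have hmul : MemLp (fun w : ℂ × ℂ => c * w.2) (ENNReal.ofReal p) (bidiskMeasure q) :=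
    ((memLp_comp_hartogsMap_iff (Lp.aestronglyMeasurable _)).2 hBf).ae_eq
      (ae_bergmanProjection_snd_mul_norm_rpow hq1 hq2 (by linarith) hf2.coeFn_toLp)
  have hsnd : MemLp (fun w : ℂ × ℂ => w.2 * (‖w.2‖ ^ (0 : ℝ) : ℝ)) (ENNReal.ofReal p)
      (bidiskMeasure q) := by
    simpa only [inv_mul_cancel_left₀ hc0, Real.rpow_zero, Complex.ofReal_one, mul_one]
      using hmul.const_mul c⁻¹
  simpa using (memLp_snd_mul_norm_rpow_iff hp).1 hsnd

theorem bergmanProjectionLpBounded_hartogs_iff {q p : ℝ} (hq1 : 1 ≤ q) (hq2 : q < 2)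
    (hp : 0 < p) :
    BergmanProjectionLpBounded hartogsTriangle (hartogsWeight (-(q + 4))) p ↔
      q < p ∧ p * q < p + q := by
  refine ⟨fun h => ?_, fun h => bergmanProjectionLpBounded_of_lt hq1 h.1 h.2⟩
  have hqp := lt_of_bergmanProjectionLpBounded hq1 hq2 hp h
  have hpp := Real.HolderConjugate.conjExponent (hq1.trans_lt hqp)
  exact ⟨hqp, (mul_lt_add_iff_lt_of_holderConjugate hpp).2
    (lt_of_bergmanProjectionLpBounded hq1 hq2 hpp.symm.pos (h.of_holderConjugate hpp))⟩

end Unboundedness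

theorem not_bddAbove_hartogsWeight {s : ℝ} (hs : s < 0) :
    ¬ BddAbove (hartogsWeight s '' hartogsTriangle) := by
  rintro ⟨M, hM⟩
  have hlarge : ∀ᶠ t : ℝ in 𝓝[>] 0, M < t ^ s :=
    (tendsto_rpow_neg_nhdsGT_zero hs).eventually_gt_atTop M
  obtain ⟨t, htM, ht⟩ := (hlarge.and (Ioo_mem_nhdsGT one_pos)).exists
  have hnorm : ‖(t : ℂ)‖ = t := by rw [Complex.norm_real, Real.norm_of_nonneg ht.1.le]
  have hmem : ((0 : ℂ), (t : ℂ)) ∈ hartogsTriangle := by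
    simpa only [hartogsTriangle, mem_ofPred_eq, norm_zero, hnorm] using ht
  have hle := hM (mem_image_of_mem _ hmem)
  rw [hartogsWeight, hnorm] at hle
  exact hle.not_gt htM

theorem ofReal_lt_iff_of_holderConjugate {q p : ℝ} (hq : 1 ≤ q) (hp : 0 < p) {q' : ℝ≥0∞}
    (h : (ENNReal.ofReal q).HolderConjugate q') : ENNReal.ofReal p < q' ↔ p * q < p + q := by
  have hq0 : 0 < q := one_pos.trans_le hq
  have hinv : q'⁻¹ = ENNReal.ofReal (1 - q⁻¹) := by
    rw [ENNReal.ofReal_sub _ (by positivity), ENNReal.ofReal_one, ENNReal.ofReal_inv_of_pos hq0]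
    exact ENNReal.eq_sub_of_add_eq' ENNReal.one_ne_top (h.symm.inv_add_inv_eq_one _ _)
  have hadd : p⁻¹ + q⁻¹ = (p + q) / (p * q) := by
    field_simp
    ring
  rw [← ENNReal.inv_lt_inv, hinv, ← ENNReal.ofReal_inv_of_pos hp,
    ENNReal.ofReal_lt_ofReal_iff (by positivity), sub_lt_iff_lt_add, hadd,
    lt_div_iff₀ (by positivity), one_mul]

theorem corollary1p2_general :
    (∀ p₀ : ℝ, 1 ≤ p₀ → p₀ < 2 →
      ∀ p₀' : ℝ≥0∞, (ENNReal.ofReal p₀).HolderConjugate p₀' →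
        ∀ p : ℝ, 0 < p →
          (BergmanProjectionLpBounded hartogsTriangle (hartogsWeight (-(p₀ + 4))) p ↔
            p₀ < p ∧ ENNReal.ofReal p < p₀')) ∧
    (∀ ε : ℝ, 0 < ε →
      ∃ s : ℝ, ¬ BddAbove (hartogsWeight s '' hartogsTriangle) ∧
        {p : ℝ | 0 < p ∧ BergmanProjectionLpBounded hartogsTriangle (hartogsWeight s) p} ⊆
          Ioo (2 - ε) (2 + ε)) := by
  refine ⟨fun q hq1 hq2 q' hq' p hp => ?_, fun ε hε => ?_⟩
  · rw [ofReal_lt_iff_of_holderConjugate hq1 hp hq']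
    exact bergmanProjectionLpBounded_hartogs_iff hq1 hq2 hp
  · obtain ⟨d, hd0, hd1, hdε⟩ : ∃ d : ℝ, 0 < d ∧ d ≤ 1 / 2 ∧ d ≤ ε / 2 :=
      ⟨min (1 / 2) (ε / 2), by positivity, min_le_left _ _, min_le_right _ _⟩
    refine ⟨-((2 - d) + 4), not_bddAbove_hartogsWeight (by linarith), fun p ⟨hp0, hp⟩ => ?_⟩
    obtain ⟨hlower, hupper⟩ :=
      (bergmanProjectionLpBounded_hartogs_iff (by linarith) (by linarith) hp0).1 hp
    exact ⟨by linarith, by nlinarith⟩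

theorem corollary1p2 :
    (∀ p₀ : ℝ, 1 ≤ p₀ → p₀ < 2 →
      ∀ p₀' : ℝ≥0∞, (ENNReal.ofReal p₀).HolderConjugate p₀' →
        ∀ p : ℝ, 1 ≤ p →
          (BergmanProjectionLpBounded hartogsTriangle (hartogsWeight (-(p₀ + 4))) p ↔
            p₀ < p ∧ ENNReal.ofReal p < p₀')) ∧
    (∀ ε : ℝ, 0 < ε →
      ∃ s : ℝ, ¬ BddAbove (hartogsWeight s '' hartogsTriangle) ∧
        {p : ℝ | 1 ≤ p ∧ BergmanProjectionLpBounded hartogsTriangle (hartogsWeight s) p} ⊆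
          Ioo (2 - ε) (2 + ε)) := by
  refine ⟨fun q hq1 hq2 q' hq' p hp => corollary1p2_general.1 q hq1 hq2 q' hq' p (by linarith),
    fun ε hε => ?_⟩
  obtain ⟨s, hs, hrange⟩ := corollary1p2_general.2 ε hε
  exact ⟨s, hs, fun p hp => hrange ⟨one_pos.trans_le hp.1, hp.2⟩⟩
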